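/- All graphs are finite and simple. For a graph $G$ and an integer $n_0\ge 1$, let $\mathrm{mad}(G,n_0)$ be the maximum of the average degree $2|E(H)|/|V(H)|$ over all subgraphs $H$ of $G$ with at least $n_0$ vertices, where $\mathrm{mad}(G,n_0):=0$ if $|V(G)|<n_0$. A colouring of $G$ (an arbitrary assignment of colours to the vertices, not necessarily proper) has clustering $c$ if every connected component of its monochromatic subgraph (the spanning subgraph of $G$ consisting of the edges whose two endpoints have the same colour) has at most $c$ vertices. $G$ is $k$-choosable with clustering $c$ if, for every assignment of a set $L(v)$ of at least $k$ colours to each vertex $v$ of $G$, there is a colouring of $G$ with clustering $c$ in which each vertex $v$ receives a colour from $L(v)$. Theorem. For all integers $n_0\ge 1$ and $k\ge 1$, every graph $G$ with $\mathrm{mad}(G,n_0)<\frac32 k$ is $k$-choosable with clustering $$\max\left\{\left\lceil \frac{n_0-1}{k}\right\rceil,\ 57k-51\right\}.$$ -/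

import Mathlib

universe u w

namespace ClusteredChoosability

variable {V : Type u}

/-- The average degree `2 |E(H)| / |V(H)|` of a (finite, nonempty) subgraph `H` of `G`. -/
noncomputable def avgDegree {G : SimpleGraph V} (H : G.Subgraph) : ℝ :=
  2 * (H.edgeSet.ncard : ℝ) / (H.verts.ncard : ℝ)

/-- `mad G n₀`: for a finite graph `G` and `n₀ ≥ 1`, the maximum average degree of a subgraph of
`G` with at least `n₀` vertices, or `0` if `G` has fewer than `n₀` vertices. The supremum is a
maximum, see `isGreatest_mad`. -/
noncomputable def mad (G : SimpleGraph V) (n₀ : ℕ) : ℝ :=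
  if Nat.card V < n₀ then 0
  else sSup {x : ℝ | ∃ H : G.Subgraph, n₀ ≤ H.verts.ncard ∧ x = avgDegree H}

/-- If `G` has at least `n₀` vertices, then the supremum defining `mad G n₀` is attained. -/
theorem isGreatest_mad [Finite V] (G : SimpleGraph V) (n₀ : ℕ) (h : n₀ ≤ Nat.card V) :
    IsGreatest {x : ℝ | ∃ H : G.Subgraph, n₀ ≤ H.verts.ncard ∧ x = avgDegree H} (mad G n₀) := by
  have hfin : {x : ℝ | ∃ H : G.Subgraph, n₀ ≤ H.verts.ncard ∧ x = avgDegree H}.Finite := by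
    refine (Set.finite_range (fun H : G.Subgraph => avgDegree H)).subset ?_
    rintro x ⟨H, -, rfl⟩
    exact ⟨H, rfl⟩
  have hne : {x : ℝ | ∃ H : G.Subgraph, n₀ ≤ H.verts.ncard ∧ x = avgDegree H}.Nonempty :=
    ⟨avgDegree (⊤ : G.Subgraph), ⊤, by simpa [Set.ncard_univ] using h, rfl⟩
  rw [mad, if_neg (not_lt.mpr h)]
  exact ⟨hne.csSup_mem hfin, fun x hx => le_csSup hfin.bddAbove hx⟩

/-- The monochromatic subgraph of `G` under the colouring `φ`: the spanning subgraph consisting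
of the edges whose endpoints have the same colour. -/
def monoSubgraph {α : Type w} (G : SimpleGraph V) (φ : V → α) : SimpleGraph V where
  Adj x y := G.Adj x y ∧ φ x = φ y
  symm := ⟨fun _ _ h => ⟨h.1.symm, h.2.symm⟩⟩
  loopless := ⟨fun x h => G.loopless.irrefl x h.1⟩

/-- The colouring `φ` of `G` has clustering `c`: every monochromatic component has at most `c`
vertices. -/
def HasClustering {α : Type w} (G : SimpleGraph V) (φ : V → α) (c : ℕ) : Prop :=
  ∀ C : (monoSubgraph G φ).ConnectedComponent, C.supp.encard ≤ (c : ℕ∞)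

/-- `G` is `k`-choosable with clustering `c`: for every assignment `L` of a list `L v` of at
least `k` colours to each vertex `v`, there is a colouring with clustering `c` in which each
vertex receives a colour from its list. -/
def ChoosableWithClustering (G : SimpleGraph V) (k c : ℕ) : Prop :=
  ∀ (α : Type w) (L : V → Set α), (∀ v, (k : ℕ∞) ≤ (L v).encard) →
    ∃ φ : V → α, (∀ v, φ v ∈ L v) ∧ HasClustering G φ c

end ClusteredChoosability

/-! Reduction. Among subsets `R` of the current vertex set `A`, maximise the sum over `R` of (degree
into `A` plus degree into `R`), minus `3k|R|`. When `A` has at least `n₀` vertices, the density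
bound makes the value at `A` negative, so `R ≠ A`. Colour `R` by induction, and delete from the
lists on `X = A \ R` the colours of neighbours in `R`. No monochromatic edge then joins `R` to `X`,
and maximality (`exists_extendable`) says that every nonempty `T ⊆ X` has total degree into `X` plus
total degree into `T` less than three times its total list size. Sets with fewer than `n₀` vertices
get a balanced colouring.

Core (`exists_clustering`). Under this list condition, take a list colouring with fewest
monochromatic edges and, among those, fewest monochromatically isolated vertices. Monochromatic
degrees are at most 2, so components are paths and cycles, possibly long. A switch recolours a
vertex away from path ends with a colour seen on exactly two neighbours; the edge count does not
change, and optimality forces both neighbours to be path ends (`IsSwitch.nCol_target`). Cut the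
interiors of long components into connected blocks. The list condition gives a block `B` at least
`|B| - 1` switches (`card_le_sum_card_switchCols`), whereas a switch conflicts with at most `5k - 4`
others (`card_switchConflict_le`). Haxell's theorem therefore selects one switch per block without
conflicts. The selected vertices cut the long components into bounded pieces, and each new component
containing a selected vertex consists of that vertex and at most two end pieces. -/

namespace ClusteredChoosability

/-! ### Independent transversals: Haxell's theorem. -/

section Transversal

open scoped Classical
open Finset

variable {P ι : Type*}

/-- `t` picks from every class `i ∈ I` of `f` on `W` one vertex, and the picked vertices are
pairwise nonadjacent. -/
def IsTransversal (G : SimpleGraph P) (W : Finset P) (f : P → ι) (I : Finset ι) (t : ι → P) :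
    Prop :=
  (∀ i ∈ I, t i ∈ W ∧ f (t i) = i) ∧ ∀ i ∈ I, ∀ j ∈ I, ¬ G.Adj (t i) (t j)

theorem IsTransversal.mono {G H : SimpleGraph P} {W : Finset P} {f : P → ι} {I J : Finset ι}
    {t : ι → P} (ht : IsTransversal G W f I t) (hH : H ≤ G) (hJ : J ⊆ I) :
    IsTransversal H W f J t :=
  ⟨fun i hi => ht.1 i (hJ hi), fun i hi j hj h => ht.2 i (hJ hi) j (hJ hj) (hH h)⟩

/-- If there is an independent transversal of all classes but `a`, but none of all classes, then
some set `S` of classes containing `a` is dominated by at most `2 (|S| - 1)` vertices. -/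
theorem exists_dominating_of_not_isTransversal [Finite P] (n : ℕ) :
    ∀ (G : SimpleGraph P) (W : Finset P) (f : P → ι) (I : Finset ι) (a : ι), #I = n → a ∈ I →
    (¬ ∃ t, IsTransversal G W f I t) → (∃ t, IsTransversal G W f (I.erase a) t) →
    ∃ S ⊆ I, a ∈ S ∧ ∃ D : Finset P, #D + 2 ≤ 2 * #S ∧
      ∀ v ∈ W, f v ∈ S → ∃ d ∈ D, G.Adj d v := by
  induction n with
  | zero =>
    intro G W f I a hI ha
    simp [Finset.card_eq_zero.mp hI] at ha
  | succ n ih =>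
    intro G W f I a hI ha hno ⟨t₀, ht₀⟩
    -- With an edge-minimal obstruction, deleting any edge `xy` creates a transversal, which must
    -- contain both `x` and `y`.
    obtain ⟨G₁, ⟨hG₁, hno₁⟩, hmin⟩ :=
      (Set.toFinite {H : SimpleGraph P | H ≤ G ∧ ¬ ∃ t, IsTransversal H W f I t}).exists_minimal
        ⟨G, le_rfl, hno⟩
    by_cases hA : ∃ x ∈ W, f x = a
    swap
    · refine ⟨{a}, by simpa using ha, by simp, ∅, by simp, fun v hv hfv => ?_⟩
      exact absurd ⟨v, hv, by simpa using hfv⟩ hA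
    obtain ⟨x, hxW, hxa⟩ := hA
    have ht₁ := ht₀.mono hG₁ subset_rfl
    have hupd : ∃ j ∈ I, j ≠ a ∧ G₁.Adj x (t₀ j) := by
      by_contra! hcon
      refine hno₁ ⟨Function.update t₀ a x, fun i hi => ?_, fun i hi j hj hadj => ?_⟩
      · by_cases h : i = a
        · subst h; simp [hxW, hxa]
        · simpa [h] using ht₁.1 i (mem_erase.2 ⟨h, hi⟩)
      · by_cases h : i = a <;> by_cases h' : j = a
        · subst h; subst h'; simp at hadj
        · subst h; simp [h'] at hadj; exact hcon j hj h' hadj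
        · subst h'; simp [h] at hadj; exact hcon i hi h hadj.symm
        · simp [h, h'] at hadj
          exact ht₁.2 i (mem_erase.2 ⟨h, hi⟩) j (mem_erase.2 ⟨h', hj⟩) hadj
    obtain ⟨j, hjI, hja, hxy⟩ := hupd
    set y := t₀ j with hy
    have hyj : f y = j := (ht₁.1 j (mem_erase.2 ⟨hja, hjI⟩)).2
    have hyW : y ∈ W := (ht₁.1 j (mem_erase.2 ⟨hja, hjI⟩)).1
    have hdel : ∃ t, IsTransversal (G₁.deleteEdges {s(x, y)}) W f I t := by
      by_contra hcon
      have := hmin ⟨(G₁.deleteEdges_le _).trans hG₁, hcon⟩ (G₁.deleteEdges_le _) hxy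
      simp at this
    obtain ⟨t, ht⟩ := hdel
    have key : ∀ i ∈ I, ∀ i' ∈ I, G₁.Adj (t i) (t i') → s(t i, t i') = s(x, y) := by
      intro i hi i' hi' h
      by_contra hne
      exact ht.2 i hi i' hi' (by rw [SimpleGraph.deleteEdges_adj]; exact ⟨h, hne⟩)
    have hxy' : t a = x ∧ t j = y := by
      have : ∃ i ∈ I, ∃ i' ∈ I, G₁.Adj (t i) (t i') := by
        by_contra! hcon
        exact hno₁ ⟨t, ht.1, hcon⟩
      obtain ⟨i, hi, i', hi', h⟩ := this
      have e := key i hi i' hi' h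
      have h1 := (ht.1 i hi).2
      have h2 := (ht.1 i' hi').2
      rw [Sym2.eq_iff] at e
      rcases e with ⟨e1, e2⟩ | ⟨e1, e2⟩
      · rw [e1, hxa] at h1; rw [e2, hyj] at h2; subst h1; subst h2; exact ⟨e1, e2⟩
      · rw [e1, hyj] at h1; rw [e2, hxa] at h2; subst h1; subst h2; exact ⟨e2, e1⟩
    obtain ⟨hta, htj⟩ := hxy'
    -- Merge class `a` into class `j` and discard everything dominated by `x` or `y`. A transversal
    -- of the merged system lifts: its vertex in the merged class serves one of `a`, `j`, and `x` or
    -- `y` serves the other. Each merging costs two dominating vertices and one class.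
    let W' := W.filter fun v => ¬ G₁.Adj x v ∧ ¬ G₁.Adj y v
    let f' : P → ι := fun v => if f v = a then j else f v
    have hf' : ∀ v i, f' v = i → i ≠ j → f v = i := by
      intro v i h hi
      by_cases hv : f v = a
      · simp [f', hv] at h; exact absurd h.symm hi
      · simpa [f', hv] using h
    have hno' : ¬ ∃ t', IsTransversal G₁ W' f' (I.erase a) t' := by
      rintro ⟨t', ht'⟩
      have hW' : ∀ i ∈ I, i ≠ a → t' i ∈ W ∧ ¬ G₁.Adj x (t' i) ∧ ¬ G₁.Adj y (t' i) := by
        intro i hi hia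
        simpa [W'] using (ht'.1 i (mem_erase.2 ⟨hia, hi⟩)).1
      have hfi : ∀ i ∈ I, i ≠ a → i ≠ j → f (t' i) = i := fun i hi hia hij =>
        hf' _ _ (ht'.1 i (mem_erase.2 ⟨hia, hi⟩)).2 hij
      have hind : ∀ i ∈ I, i ≠ a → ∀ i' ∈ I, i' ≠ a → ¬ G₁.Adj (t' i) (t' i') :=
        fun i hi hia i' hi' hia' =>
          ht'.2 i (mem_erase.2 ⟨hia, hi⟩) i' (mem_erase.2 ⟨hia', hi'⟩)
      by_cases hc : f (t' j) = a
      · refine hno₁ ⟨fun i => if i = a then t' j else if i = j then y else t' i,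
          fun i hi => ?_, fun i hi i' hi' hadj => ?_⟩
        · by_cases h : i = a
          · subst h; simp [hc, (hW' j hjI hja).1]
          · by_cases h' : i = j
            · subst h'; simp [h, hyj, hyW]
            · simp [h, h', (hW' i hi h).1, hfi i hi h h']
        · have hh := hW' j hjI hja
          by_cases h1 : i = a <;> by_cases h2 : i = j <;> by_cases h3 : i' = a <;>
            by_cases h4 : i' = j <;> simp only [h1, h2, h3, h4, hja, hja.symm, if_true, if_false] at hadj <;>
            first
              | exact G₁.loopless.irrefl _ hadj
              | exact hh.2.2 hadj
              | exact hh.2.2 hadj.symm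
              | exact hind _ hjI hja _ ‹_› ‹_› hadj
              | exact hind _ hi ‹_› _ hjI hja hadj
              | exact hind _ hi ‹_› _ hi' ‹_› hadj
              | exact (hW' _ hi' ‹_›).2.2 hadj
              | exact (hW' _ hi ‹_›).2.2 hadj.symm
      · have hcj : f (t' j) = j := by
          have := (ht'.1 j (mem_erase.2 ⟨hja, hjI⟩)).2
          simpa [f', hc] using this
        refine hno₁ ⟨fun i => if i = a then x else t' i,
          fun i hi => ?_, fun i hi i' hi' hadj => ?_⟩
        · by_cases h : i = a
          · subst h; simp [hxW, hxa]
          · by_cases h' : i = j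
            · subst h'; simp [h, hcj, (hW' i hi h).1]
            · simp [h, (hW' i hi h).1, hfi i hi h h']
        · by_cases h : i = a <;> by_cases h' : i' = a <;>
            simp only [h, h', if_true, if_false] at hadj
          · exact G₁.loopless.irrefl _ hadj
          · exact (hW' _ hi' h').2.1 hadj
          · exact (hW' _ hi h).2.1 hadj.symm
          · exact hind _ hi h _ hi' h' hadj
    have hyes' : ∃ t', IsTransversal G₁ W' f' ((I.erase a).erase j) t' := by
      refine ⟨t, fun i hi => ?_, fun i hi i' hi' hadj => ?_⟩
      · simp only [mem_erase] at hi
        obtain ⟨hij, hia, hi⟩ := hi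
        refine ⟨?_, by simp [f', (ht.1 i hi).2, hia]⟩
        simp only [W', mem_filter]
        refine ⟨(ht.1 i hi).1, fun h => ?_, fun h => ?_⟩
        · have := key a ha i hi (by rwa [hta])
          rw [hta, Sym2.congr_right] at this
          exact hij ((ht.1 i hi).2.symm.trans (this ▸ hyj))
        · have := key j hjI i hi (by rwa [htj])
          rw [htj, Sym2.eq_swap (a := x), Sym2.congr_right] at this
          exact hia ((ht.1 i hi).2.symm.trans (this ▸ hxa))
      · simp only [mem_erase] at hi hi'
        have := key i hi.2.2 i' hi'.2.2 hadj
        rw [Sym2.eq_iff] at this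
        rcases this with ⟨e1, -⟩ | ⟨e1, -⟩
        · exact hi.2.1 ((ht.1 i hi.2.2).2.symm.trans (e1 ▸ hxa))
        · exact hi.1 ((ht.1 i hi.2.2).2.symm.trans (e1 ▸ hyj))
    obtain ⟨S', hS'I, hjS', D', hD', hdom⟩ := ih G₁ W' f' (I.erase a) j
      (by rw [card_erase_of_mem ha, hI]; rfl) (mem_erase.2 ⟨hja, hjI⟩) hno' hyes'
    have haS' : a ∉ S' := fun h => by simpa using hS'I h
    refine ⟨insert a S', insert_subset ha (hS'I.trans (erase_subset _ _)), by simp,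
      insert x (insert y D'), ?_, fun v hv hfv => ?_⟩
    · rw [card_insert_of_notMem haS']
      have h1 := card_insert_le x (insert y D')
      have h2 := card_insert_le y D'
      omega
    · by_cases h1 : G₁.Adj x v
      · exact ⟨x, by simp, hG₁ h1⟩
      by_cases h2 : G₁.Adj y v
      · exact ⟨y, by simp, hG₁ h2⟩
      obtain ⟨d, hd, hdv⟩ := hdom v (by simp [W', hv, h1, h2]) (by
        by_cases h : f v = a
        · simpa [f', h] using hjS'
        · simpa [f', h] using hfv)
      exact ⟨d, by simp [hd], hG₁ hdv⟩

/-- Haxell's theorem on independent transversals. -/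
theorem exists_isTransversal [Fintype P] [Nonempty P] (G : SimpleGraph P) (f : P → ι) (Δ : ℕ)
    (hΔ : ∀ p, #{q | G.Adj p q} ≤ Δ) (I : Finset ι) (hI : ∀ i ∈ I, 2 * Δ < #{p | f p = i}) :
    ∃ t, IsTransversal G univ f I t := by
  induction I using Finset.induction_on with
  | empty => exact ⟨fun _ => Classical.arbitrary P, by simp [IsTransversal]⟩
  | insert a I ha ih =>
    by_contra hno
    obtain ⟨S, hS, haS, D, hD, hdom⟩ := exists_dominating_of_not_isTransversal _ G univ f _ a rfl
      (mem_insert_self a I) hno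
      (by rw [erase_insert ha]; exact ih fun i hi => hI i (mem_insert_of_mem hi))
    have h1 : ∑ i ∈ S, (2 * Δ + 1) ≤ ∑ i ∈ S, #{p | f p = i} :=
      sum_le_sum fun i hi => hI i (hS hi)
    have h2 : ∑ i ∈ S, #{p | f p = i} ≤ #(D.biUnion fun d => {q | G.Adj d q}) := by
      rw [← card_biUnion]
      · refine card_le_card fun p hp => ?_
        simp only [mem_biUnion, mem_filter, mem_univ, true_and] at hp ⊢
        obtain ⟨i, hi, rfl⟩ := hp
        exact hdom p (mem_univ _) hi
      · intro i _ j _ hij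
        rw [Function.onFun, disjoint_left]
        intro p hp hp'
        simp only [mem_filter, mem_univ, true_and] at hp hp'
        exact hij (hp.symm.trans hp')
    have h3 : #(D.biUnion fun d => {q | G.Adj d q}) ≤ #D * Δ :=
      card_biUnion_le_card_mul _ _ _ fun d _ => hΔ d
    simp only [sum_const, smul_eq_mul] at h1
    -- The classes in `S` contain at least `(2Δ + 1)|S|` vertices, more than `D` can dominate.
    have h4 : #D * Δ ≤ (2 * #S) * Δ := Nat.mul_le_mul_right _ (by omega)
    have h5 : 1 ≤ #S := card_pos.2 ⟨a, haS⟩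
    nlinarith

end Transversal

/-! ### Connected vertex sets, and cutting them up when the maximum degree is 2. -/

section Connected

open scoped Classical
open Finset

variable {V : Type u}

/-- The number of neighbours of `v` in `T`. -/
noncomputable def degIn (M : SimpleGraph V) (T : Finset V) (v : V) : ℕ := #{w ∈ T | M.Adj v w}

/-- `T` induces a connected (or empty) subgraph: every nontrivial cut is crossed by an edge. -/
def SetConn (M : SimpleGraph V) (T : Finset V) : Prop :=
  ∀ A ⊆ T, A.Nonempty → A ≠ T → ∃ a ∈ A, ∃ b ∈ T, b ∉ A ∧ M.Adj a b

theorem SetConn.mono {M N : SimpleGraph V} {T : Finset V} (h : SetConn M T) (hMN : M ≤ N) :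
    SetConn N T := fun A hA hne hAT =>
  let ⟨a, ha, b, hb, hbA, hab⟩ := h A hA hne hAT
  ⟨a, ha, b, hb, hbA, hMN hab⟩

theorem degIn_mono (M : SimpleGraph V) {S T : Finset V} (h : S ⊆ T) (v : V) :
    degIn M S v ≤ degIn M T v :=
  card_le_card (filter_subset_filter _ h)

theorem degIn_lt_of_adj {M : SimpleGraph V} {S T : Finset V} (h : S ⊆ T) {v w : V} (hwT : w ∈ T)
    (hwS : w ∉ S) (hvw : M.Adj v w) : degIn M S v < degIn M T v :=
  card_lt_card (ssubset_iff_of_subset (filter_subset_filter _ h) |>.2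
    ⟨w, by simp [hwT, hvw], by simp [hwS]⟩)

theorem setConn_empty (M : SimpleGraph V) : SetConn M ∅ := fun A hA hne _ => by
  simp [subset_empty.1 hA] at hne

theorem setConn_singleton (M : SimpleGraph V) (v : V) : SetConn M {v} := fun A hA hne hA' => by
  rcases subset_singleton_iff.1 hA with rfl | rfl <;> simp_all

theorem SetConn.insert_adj {M : SimpleGraph V} {A : Finset V} (hA : SetConn M A) {a b : V}
    (ha : a ∈ A) (hab : M.Adj a b) : SetConn M (insert b A) := by
  intro B hB hne hBT
  by_cases hbA : b ∈ A
  · rw [insert_eq_of_mem hbA] at *; exact hA B hB hne hBT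
  by_cases hb : b ∈ B
  · have hsub : B.erase b ⊆ A := fun x hx => by
      rcases mem_erase.1 hx with ⟨h1, h2⟩
      exact (mem_insert.1 (hB h2)).resolve_left h1
    by_cases hE : (B.erase b).Nonempty
    · obtain ⟨x, hx, y, hy, hyB, hxy⟩ := hA _ hsub hE (fun h => hBT (by
        rw [← h, insert_erase hb]))
      refine ⟨x, mem_of_mem_erase hx, y, mem_insert_of_mem hy, fun h => hyB ?_, hxy⟩
      exact mem_erase.2 ⟨fun h' => hbA (h' ▸ hy), h⟩
    · refine ⟨b, hb, a, mem_insert_of_mem ha, fun h => hE ⟨a, mem_erase.2 ⟨hab.ne, h⟩⟩, hab.symm⟩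
  · have hsub : B ⊆ A := fun x hx =>
      (mem_insert.1 (hB hx)).resolve_left (fun h => hb (h ▸ hx))
    by_cases hBA : B = A
    · exact ⟨a, hBA ▸ ha, b, mem_insert_self _ _, hb, hab⟩
    · obtain ⟨x, hx, y, hy, hyB, hxy⟩ := hA _ hsub hne hBA
      exact ⟨x, hx, y, mem_insert_of_mem hy, hyB, hxy⟩

/-- Grow a tree: each new vertex is attached by an edge and so adds at least 2 to the internal
degree sum. -/
theorem SetConn.exists_subset_card {M : SimpleGraph V} {T : Finset V} (hT : SetConn M T) (j : ℕ)
    (hj : j ≤ #T) :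
    ∃ A ⊆ T, #A = j ∧ SetConn M A ∧ 2 * j ≤ ∑ v ∈ A, degIn M A v + 2 := by
  induction j with
  | zero => exact ⟨∅, by simp, by simp, setConn_empty M, by simp⟩
  | succ j ih =>
    obtain ⟨A, hAT, hAj, hA, hsum⟩ := ih (by omega)
    rcases A.eq_empty_or_nonempty with rfl | hne
    · obtain ⟨x, hx⟩ := card_pos.1 (by omega : 0 < #T)
      simp at hAj
      subst hAj
      exact ⟨{x}, by simpa using hx, by simp, setConn_singleton M x, by simp⟩
    obtain ⟨a, ha, b, hb, hbA, hab⟩ := hT A hAT hne (fun h => by subst h; omega)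
    refine ⟨insert b A, insert_subset hb hAT, by rw [card_insert_of_notMem hbA, hAj],
      hA.insert_adj ha hab, ?_⟩
    rw [sum_insert hbA]
    have h1 : ∑ v ∈ A, degIn M A v < ∑ v ∈ A, degIn M (insert b A) v :=
      sum_lt_sum (fun v _ => degIn_mono M (subset_insert _ _) v)
        ⟨a, ha, degIn_lt_of_adj (subset_insert _ _) (mem_insert_self _ _) hbA hab⟩
    have h2 : 1 ≤ degIn M (insert b A) b :=
      card_pos.2 ⟨a, by simp [ha, hab.symm]⟩
    omega

theorem SetConn.two_mul_card_le {M : SimpleGraph V} {T : Finset V} (hT : SetConn M T) :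
    2 * #T ≤ ∑ v ∈ T, degIn M T v + 2 := by
  obtain ⟨A, hAT, hA, -, h⟩ := hT.exists_subset_card #T le_rfl
  rwa [eq_of_subset_of_card_le hAT hA.ge] at h

theorem SetConn.erase_leaf {M : SimpleGraph V} {T : Finset V} (hT : SetConn M T) {x : V}
    (hdeg : degIn M T x ≤ 1) : SetConn M (T.erase x) := by
  intro A hA hne hAT
  by_contra! hcon
  have hxA : x ∉ A := fun h => by simpa using hA h
  by_cases hx : x ∈ T
  swap
  · rw [erase_eq_of_notMem hx] at *
    obtain ⟨a, ha, b, hb, hbA, hab⟩ := hT A hA hne hAT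
    exact hcon a ha b hb hbA hab
  obtain ⟨a, ha, b, hb, hbA, hab⟩ := hT A (hA.trans (erase_subset _ _)) hne
    (fun h => hxA (h ▸ hx))
  have hbx : b = x := by
    by_contra hbx
    exact hcon a ha b (mem_erase.2 ⟨hbx, hb⟩) hbA hab
  subst hbx
  obtain ⟨c, hc, d, hd, hdA, hcd⟩ := hT (insert b A)
    (insert_subset hx (hA.trans (erase_subset _ _))) (insert_nonempty _ _)
    (fun h => hAT (by rw [← h, erase_insert hxA]))
  rw [mem_insert, not_or] at hdA
  rcases mem_insert.1 hc with rfl | hc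
  · have : #{a, d} ≤ degIn M T c := card_le_card (by
      intro z hz
      rcases mem_insert.1 hz with rfl | hz
      · simp [hab.symm, mem_of_mem_erase (hA ha)]
      · rw [mem_singleton] at hz; subst hz; simp [hcd, hd])
    rw [card_pair (show a ≠ d from fun h => hdA.2 (h ▸ ha))] at this
    omega
  · exact hcon c hc d (mem_erase.2 ⟨hdA.1, hd⟩) hdA.2 hcd

/-- Given a cut `A` of the remaining set, add to `A` its pendant neighbours. An edge crossing the
enlarged cut cannot start at a pendant vertex, whose only neighbour is in `A`, nor end at one, so it
crosses the original cut between two surviving vertices. -/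
theorem SetConn.filter_two_le_degIn {M : SimpleGraph V} {T : Finset V} (hT : SetConn M T) :
    SetConn M {v ∈ T | 2 ≤ degIn M T v} := by
  intro A hA hne hAT
  by_contra! hcon
  have hAT' : A ⊆ T := hA.trans (filter_subset _ _)
  obtain ⟨z, hz, hzA⟩ := exists_of_ssubset (Finset.ssubset_iff_subset_ne.2 ⟨hA, hAT⟩)
  rw [mem_filter] at hz
  have huniq : ∀ x ∈ T, degIn M T x < 2 → ∀ y ∈ T, ∀ y' ∈ T, M.Adj x y → M.Adj x y' → y = y' := by
    intro x _ hx y hy y' hy' h h'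
    exact card_le_one.1 (Nat.le_of_lt_succ hx) y (by simp [hy, h]) y' (by simp [hy', h'])
  obtain ⟨a, ha, b, hb, hbA, hab⟩ := hT
    {v ∈ T | v ∈ A ∨ (degIn M T v < 2 ∧ ∃ y ∈ A, M.Adj v y)} (filter_subset _ _)
    (hne.mono fun x hx => by simp [hAT' hx, hx]) (fun h => by
      have := h.symm ▸ hz.1
      simp only [mem_filter] at this
      rcases this.2 with h | h
      · exact hzA h
      · omega)
  simp only [mem_filter, not_and, not_or, not_exists] at ha hbA
  obtain ⟨hbA1, hbA2⟩ := hbA hb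
  rcases ha.2 with haA | ⟨ha2, y, hy, hay⟩
  · by_cases hb2 : degIn M T b < 2
    · exact hbA2 hb2 a haA hab.symm
    · exact hcon a haA b (by simp [hb]; omega) hbA1 hab
  · exact hbA1 (huniq a ha.1 ha2 y (hAT' hy) b hb hay hab ▸ hy)

variable [Fintype V]

/-- Move one vertex at a time from the remainder to `A`. A vertex with a neighbour in `A` has at
most one neighbour left in the remainder, so it is a leaf there and its removal does not disconnect.
-/
theorem SetConn.exists_split {M : SimpleGraph V} (hM : ∀ v, degIn M univ v ≤ 2) {T : Finset V}
    (hT : SetConn M T) (j : ℕ) (hj : j ≤ #T) :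
    ∃ A ⊆ T, #A = j ∧ SetConn M A ∧ SetConn M (T \ A) := by
  induction j with
  | zero => exact ⟨∅, by simp, by simp, setConn_empty M, by simpa using hT⟩
  | succ j ih =>
    obtain ⟨A, hAT, hAj, hA, hTA⟩ := ih (by omega)
    rcases A.eq_empty_or_nonempty with rfl | hne
    · simp at hAj
      subst hAj
      -- The first vertex needs a separate argument: the one missed by a connected subset of size
      -- `#T - 1` is not a cut vertex.
      obtain ⟨B, hBT, hBc, hB, -⟩ := hT.exists_subset_card (#T - 1) (by omega)
      have h1 : #(T \ B) = 1 := by rw [card_sdiff_of_subset hBT]; omega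
      obtain ⟨x, hx⟩ := card_eq_one.1 h1
      refine ⟨T \ B, sdiff_subset, by simpa using h1, hx ▸ setConn_singleton M x, ?_⟩
      rwa [Finset.sdiff_sdiff_eq_self hBT]
    obtain ⟨a, ha, b, hb, hbA, hab⟩ := hT A hAT hne (fun h => by subst h; omega)
    refine ⟨insert b A, insert_subset hb hAT, by rw [card_insert_of_notMem hbA, hAj],
      hA.insert_adj ha hab, ?_⟩
    rw [sdiff_insert]
    refine hTA.erase_leaf ?_
    have := degIn_lt_of_adj (subset_univ (T \ A)) (mem_univ a) (by simp [ha]) hab.symm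
    have := hM b
    omega

theorem SetConn.exists_partition {M : SimpleGraph V} (hM : ∀ v, degIn M univ v ≤ 2) {b : ℕ}
    (hb₀ : 0 < b) (T : Finset V) (hT : SetConn M T) (hb : b ≤ #T) :
    ∃ 𝓑 : Finset (Finset V), (∀ B ∈ 𝓑, B ⊆ T ∧ SetConn M B ∧ b ≤ #B ∧ #B < 2 * b) ∧
      (∀ B ∈ 𝓑, ∀ B' ∈ 𝓑, ∀ v ∈ B, v ∈ B' → B = B') ∧ ∀ v ∈ T, ∃ B ∈ 𝓑, v ∈ B := by
  induction hn : #T using Nat.strong_induction_on generalizing T with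
  | _ n ih =>
  subst hn
  by_cases hlt : #T < 2 * b
  · exact ⟨{T}, by simp [hT, hb, hlt], by simp, by simp⟩
  obtain ⟨A, hAT, hAb, hA, hTA⟩ := hT.exists_split hM b hb
  have hc := card_sdiff_add_card_eq_card hAT
  obtain ⟨𝓑, h1, h2, h3⟩ := ih #(T \ A) (by omega) (T \ A) hTA (by omega) rfl
  refine ⟨insert A 𝓑, ?_, ?_, fun v hv => ?_⟩
  · intro B hB
    rcases mem_insert.1 hB with rfl | hB
    · exact ⟨hAT, hA, hAb.ge, by omega⟩
    · exact ⟨(h1 B hB).1.trans sdiff_subset, (h1 B hB).2⟩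
  · have hdis : ∀ B ∈ 𝓑, ∀ v ∈ B, v ∉ A := fun B hB v hv =>
      (mem_sdiff.1 ((h1 B hB).1 hv)).2
    intro B hB B' hB' v hv hv'
    rcases mem_insert.1 hB with e | e <;> rcases mem_insert.1 hB' with e' | e'
    · rw [e, e']
    · exact absurd (e ▸ hv) (hdis B' e' v hv')
    · exact absurd (e' ▸ hv') (hdis B e v hv)
    · exact h2 B e B' e' v hv hv'
  · by_cases hvA : v ∈ A
    · exact ⟨A, mem_insert_self _ _, hvA⟩
    · obtain ⟨B, hB, hvB⟩ := h3 v (mem_sdiff.2 ⟨hv, hvA⟩)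
      exact ⟨B, mem_insert_of_mem hB, hvB⟩

/-- The set of vertices reachable from `v`. -/
noncomputable def reachSet (M : SimpleGraph V) (v : V) : Finset V := {w | M.Reachable v w}

theorem mem_reachSet {M : SimpleGraph V} {v w : V} : w ∈ reachSet M v ↔ M.Reachable v w := by
  simp [reachSet]

theorem setConn_reachSet (M : SimpleGraph V) (v : V) : SetConn M (reachSet M v) := by
  intro A hA ⟨x, hx⟩ hAR
  obtain ⟨y, hy, hyA⟩ := exists_of_ssubset (Finset.ssubset_iff_subset_ne.2 ⟨hA, hAR⟩)
  have hxy : M.Reachable x y := (mem_reachSet.1 (hA hx)).symm.trans (mem_reachSet.1 hy)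
  obtain ⟨p⟩ := hxy
  obtain ⟨d, -, h1, h2⟩ := p.exists_boundary_dart (A : Set V) hx (by simpa using hyA)
  refine ⟨d.fst, h1, d.snd, ?_, by simpa using h2, d.adj⟩
  exact mem_reachSet.2 ((mem_reachSet.1 (hA h1)).trans d.adj.reachable)

theorem reachSet_subset {M : SimpleGraph V} {v : V} {T : Finset V} (hv : v ∈ T)
    (hT : ∀ x ∈ T, ∀ y, M.Adj x y → y ∈ T) : reachSet M v ⊆ T := by
  intro w hw
  obtain ⟨p⟩ := mem_reachSet.1 hw
  by_contra hwT
  obtain ⟨d, -, h1, h2⟩ := p.exists_boundary_dart (T : Set V) hv (by simpa using hwT)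
  exact h2 (hT _ h1 _ d.adj)

theorem reachSet_eq {M : SimpleGraph V} {v w : V} (h : M.Reachable v w) :
    reachSet M w = reachSet M v := by
  ext x; simp only [mem_reachSet]; exact ⟨h.trans, h.symm.trans⟩

end Connected

/-! ### Blocks of deep vertices and the sizes of the pieces left after isolating one vertex per
block. -/

section Pieces

open scoped Classical
open Finset

variable {V : Type u}

/-- The graph obtained from `M` by isolating the vertices in `S`. -/
def isolate (M : SimpleGraph V) (S : Finset V) : SimpleGraph V where
  Adj x y := M.Adj x y ∧ x ∉ S ∧ y ∉ S
  symm := ⟨fun _ _ h => ⟨h.1.symm, h.2.2, h.2.1⟩⟩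
  loopless := ⟨fun x h => M.loopless.irrefl x h.1⟩

theorem isolate_le (M : SimpleGraph V) (S : Finset V) : isolate M S ≤ M := fun _ _ h => h.1

variable [Fintype V]

theorem degIn_add_degIn_compl (M : SimpleGraph V) (T : Finset V) (v : V) :
    degIn M T v + degIn M (univ \ T) v = degIn M univ v := by
  unfold degIn
  rw [← card_union_of_disjoint (disjoint_filter_filter disjoint_sdiff), ← filter_union,
    union_sdiff_of_subset (subset_univ T)]

/-- Degrees sum to at most `2|P|`, and connectedness uses `2|P| - 2` of that inside `P`. The
remaining 2 pays for low-degree vertices and outgoing edges. -/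
theorem SetConn.card_ends_add_le {M : SimpleGraph V} (hM : ∀ v, degIn M univ v ≤ 2)
    {P : Finset V} (hP : SetConn M P) :
    #{v ∈ P | degIn M univ v ≤ 1} + ∑ v ∈ P, degIn M (univ \ P) v ≤ 2 := by
  have h1 := hP.two_mul_card_le
  have h2 : ∑ v ∈ P, (degIn M univ v + if degIn M univ v ≤ 1 then 1 else 0) ≤ ∑ v ∈ P, 2 :=
    sum_le_sum fun v _ => by have := hM v; split_ifs <;> omega
  rw [sum_add_distrib, ← card_filter] at h2
  have h3 : ∑ v ∈ P, degIn M P v + ∑ v ∈ P, degIn M (univ \ P) v = ∑ v ∈ P, degIn M univ v := by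
    rw [← sum_add_distrib]; exact sum_congr rfl fun v _ => degIn_add_degIn_compl M P v
  simp only [sum_const, smul_eq_mul] at h2
  omega

theorem eq_of_reachable_of_degIn_le_one {M : SimpleGraph V} (hM : ∀ v, degIn M univ v ≤ 2)
    {a b c : V} (hab : M.Reachable a b) (hac : M.Reachable a c) (ha : degIn M univ a ≤ 1)
    (hb : degIn M univ b ≤ 1) (hc : degIn M univ c ≤ 1) (h1 : a ≠ b) (h2 : a ≠ c) : b = c := by
  by_contra hbc
  have h := (setConn_reachSet M a).card_ends_add_le hM
  have : #{a, b, c} ≤ #{v ∈ reachSet M a | degIn M univ v ≤ 1} := card_le_card (by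
    intro x hx
    simp only [mem_insert, mem_singleton] at hx
    rcases hx with rfl | rfl | rfl <;> simp [mem_reachSet, *])
  rw [card_eq_three.2 ⟨a, b, c, h1, h2, hbc, rfl⟩] at this
  omega

/-- The vertices of degree `2` all of whose neighbours have degree `2`. -/
noncomputable def deep (M : SimpleGraph V) : Finset V :=
  {v | degIn M univ v = 2 ∧ ∀ w, M.Adj v w → degIn M univ w = 2}

theorem mem_deep {M : SimpleGraph V} {v : V} :
    v ∈ deep M ↔ degIn M univ v = 2 ∧ ∀ w, M.Adj v w → degIn M univ w = 2 := by
  simp [deep]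

/-- A vertex of `P` that is not deep is an end or the neighbour of an end, and an end has at most
one neighbour. -/
theorem card_sdiff_deep_le {M : SimpleGraph V} (hM : ∀ v, degIn M univ v ≤ 2) {P : Finset V}
    (hP : ∀ x ∈ P, ∀ y, M.Adj x y → y ∈ P ∨ y ∈ deep M) :
    #(P \ deep M) ≤ 2 * #{v ∈ P | degIn M univ v ≤ 1} := by
  set E : Finset V := {v ∈ P | degIn M univ v ≤ 1} with hE
  have hsub : P \ deep M ⊆ E ∪ E.biUnion fun z => {w ∈ univ | M.Adj z w} := by
    intro v hv
    simp only [mem_sdiff, mem_deep, not_and, not_forall] at hv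
    simp only [mem_union, mem_biUnion, hE, mem_filter, mem_univ, true_and]
    by_cases h : degIn M univ v = 2
    · right
      obtain ⟨w, hvw, hw⟩ := hv.2 h
      refine ⟨w, ⟨(hP v hv.1 w hvw).resolve_right fun h' => hw (mem_deep.1 h').1, ?_⟩, hvw.symm⟩
      have := hM w
      omega
    · left
      have := hM v
      exact ⟨hv.1, by omega⟩
  have h1 := card_le_card hsub
  have h2 := card_union_le E (E.biUnion fun z => {w ∈ univ | M.Adj z w})
  have h3 : #(E.biUnion fun z => {w ∈ univ | M.Adj z w}) ≤ #E * 1 :=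
    card_biUnion_le_card_mul _ _ _ fun z hz => (mem_filter.1 hz).2
  omega

theorem degIn_reachSet (M : SimpleGraph V) {v x : V} (hx : x ∈ reachSet M v) :
    degIn M (reachSet M v) x = degIn M univ x := by
  unfold degIn
  congr 1
  ext y
  simp only [mem_filter, mem_univ, true_and, and_iff_right_iff_imp, mem_reachSet]
  exact fun h => (mem_reachSet.1 hx).trans h.reachable

/-- Within a component, the deep vertices are what survives two rounds of deleting vertices of
degree at most 1. -/
theorem setConn_reachSet_inter_deep {M : SimpleGraph V} (hM : ∀ v, degIn M univ v ≤ 2) (v : V) :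
    SetConn M (reachSet M v ∩ deep M) := by
  have h := (setConn_reachSet M v).filter_two_le_degIn.filter_two_le_degIn
  convert h using 1
  ext x
  simp only [mem_inter, mem_filter, mem_deep]
  have hiff : ∀ y ∈ reachSet M v, (2 ≤ degIn M (reachSet M v) y ↔ degIn M univ y = 2) := by
    intro y hy
    rw [degIn_reachSet M hy]
    have := hM y
    omega
  have hset : ({y ∈ reachSet M v | 2 ≤ degIn M (reachSet M v) y} : Finset V) =
      {y ∈ reachSet M v | degIn M univ y = 2} := filter_congr hiff
  rw [hset]
  constructor
  · rintro ⟨hx, hx2, hw⟩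
    refine ⟨⟨hx, (hiff x hx).2 hx2⟩, ?_⟩
    refine hx2.ge.trans (card_le_card fun y hy => ?_)
    simp only [mem_filter, mem_univ, true_and] at hy ⊢
    exact ⟨⟨mem_reachSet.2 ((mem_reachSet.1 hx).trans hy.reachable),
      hw y hy⟩, hy⟩
  · rintro ⟨⟨hx, hx2⟩, hd⟩
    have hx2 := (hiff x hx).1 hx2
    refine ⟨hx, hx2, fun w hxw => ?_⟩
    by_contra hw
    have := degIn_lt_of_adj (S := {y ∈ reachSet M v | degIn M univ y = 2}) (subset_univ _)
      (mem_univ w) (by simp [hw]) hxw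
    omega

theorem exists_blocks {M : SimpleGraph V} (hM : ∀ v, degIn M univ v ≤ 2) {b : ℕ} (hb : 0 < b) :
    ∃ 𝓑 : Finset (Finset V), (∀ B ∈ 𝓑, B ⊆ deep M ∧ SetConn M B ∧ b ≤ #B ∧ #B < 2 * b) ∧
      (∀ B ∈ 𝓑, ∀ B' ∈ 𝓑, ∀ v ∈ B, v ∈ B' → B = B') ∧
      ∀ v, b ≤ #(reachSet M v ∩ deep M) → ∀ w ∈ reachSet M v ∩ deep M, ∃ B ∈ 𝓑, w ∈ B := by
  -- The partition is chosen as a function of the set, not of a vertex, so vertices of one component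
  -- receive the same blocks.
  have hex : ∀ T : Finset V, ∃ 𝓑 : Finset (Finset V), SetConn M T → b ≤ #T →
      (∀ B ∈ 𝓑, B ⊆ T ∧ SetConn M B ∧ b ≤ #B ∧ #B < 2 * b) ∧
      (∀ B ∈ 𝓑, ∀ B' ∈ 𝓑, ∀ v ∈ B, v ∈ B' → B = B') ∧ ∀ v ∈ T, ∃ B ∈ 𝓑, v ∈ B := by
    intro T
    by_cases h : SetConn M T ∧ b ≤ #T
    · obtain ⟨𝓑, h𝓑⟩ := h.1.exists_partition hM hb T h.2
      exact ⟨𝓑, fun _ _ => h𝓑⟩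
    · exact ⟨∅, fun h1 h2 => absurd ⟨h1, h2⟩ h⟩
  choose F hF using hex
  let Y : V → Finset V := fun v => reachSet M v ∩ deep M
  have hY : ∀ v, b ≤ #(Y v) → _ := fun v hv => hF (Y v) (setConn_reachSet_inter_deep hM v) hv
  have hmem : ∀ B, B ∈ univ.biUnion (fun v => if b ≤ #(Y v) then F (Y v) else ∅) ↔
      ∃ v, b ≤ #(Y v) ∧ B ∈ F (Y v) := by
    intro B
    simp only [mem_biUnion, mem_univ, true_and]
    refine exists_congr fun v => ?_
    split_ifs with h <;> simp [h]
  refine ⟨univ.biUnion (fun v => if b ≤ #(Y v) then F (Y v) else ∅), ?_, ?_, ?_⟩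
  · intro B hB
    obtain ⟨v, hv, hB⟩ := (hmem B).1 hB
    exact ⟨((hY v hv).1 B hB).1.trans inter_subset_right, ((hY v hv).1 B hB).2⟩
  · intro B hB B' hB' x hx hx'
    obtain ⟨v, hv, hB⟩ := (hmem B).1 hB
    obtain ⟨v', hv', hB'⟩ := (hmem B').1 hB'
    have h1 := (mem_inter.1 (((hY v hv).1 B hB).1 hx)).1
    have h2 := (mem_inter.1 (((hY v' hv').1 B' hB').1 hx')).1
    have hYY : Y v = Y v' := by
      simp only [Y]
      rw [reachSet_eq ((mem_reachSet.1 h2).trans (mem_reachSet.1 h1).symm)]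
    exact (hY v hv).2.1 B hB B' (hYY ▸ hB') x hx hx'
  · intro v hv w hw
    obtain ⟨B, hB, hwB⟩ := (hY v hv).2.2 w hw
    exact ⟨B, (hmem B).2 ⟨v, hv, hB⟩, hwB⟩

/-- If the piece has `e` ends and `o` outgoing edges, then `e + o ≤ 2`. Each block it meets contains
an isolated vertex, so it supplies an outgoing edge and at most `2b - 2` vertices. The size is
therefore at most `2e + o(2b - 2)`. Components with fewer than `b` deep vertices have at most `b +
3` vertices in all. -/
theorem card_reachSet_isolate_le {M : SimpleGraph V} (hM : ∀ v, degIn M univ v ≤ 2) {b : ℕ}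
    (hb : 3 ≤ b) {𝓑 : Finset (Finset V)}
    (h𝓑 : ∀ B ∈ 𝓑, B ⊆ deep M ∧ SetConn M B ∧ b ≤ #B ∧ #B < 2 * b)
    (hdisj : ∀ B ∈ 𝓑, ∀ B' ∈ 𝓑, ∀ v ∈ B, v ∈ B' → B = B')
    (hcov : ∀ v, b ≤ #(reachSet M v ∩ deep M) → ∀ w ∈ reachSet M v ∩ deep M, ∃ B ∈ 𝓑, w ∈ B)
    {S : Finset V} (hSD : S ⊆ deep M) (hS : ∀ B ∈ 𝓑, ∃ s ∈ B, s ∈ S) {z : V} (hz : z ∉ S) :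
    #(reachSet (isolate M S) z) ≤ 4 * b ∧
      ((∃ x ∈ reachSet (isolate M S) z, degIn M univ x ≤ 1) →
        #(reachSet (isolate M S) z) ≤ 2 * b) := by
  set P := reachSet (isolate M S) z with hPdef
  have hPC : P ⊆ reachSet M z := fun x hx =>
    mem_reachSet.2 ((mem_reachSet.1 hx).mono (isolate_le M S))
  by_cases hbig : b ≤ #(reachSet M z ∩ deep M)
  swap
  · have h1 := card_sdiff_deep_le hM (P := reachSet M z) fun x hx y hxy =>
      Or.inl (mem_reachSet.2 ((mem_reachSet.1 hx).trans hxy.reachable))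
    have h2 := (setConn_reachSet M z).card_ends_add_le hM
    have h3 := card_sdiff_add_card_inter (reachSet M z) (deep M)
    have h4 := card_le_card hPC
    constructor
    · omega
    · intro _; omega
  have hPS : ∀ x ∈ P, x ∉ S := by
    have : P ⊆ univ \ S := reachSet_subset (by simp [hz]) fun x _ y hxy => by simp [hxy.2.2]
    exact fun x hx => (mem_sdiff.1 (this hx)).2
  have hPcl : ∀ x ∈ P, ∀ y, M.Adj x y → y ∈ P ∨ y ∈ S := by
    intro x hx y hxy
    by_cases hy : y ∈ S
    · exact Or.inr hy
    · exact Or.inl (mem_reachSet.2 ((mem_reachSet.1 hx).trans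
        (SimpleGraph.Adj.reachable (G := isolate M S) ⟨hxy, hPS x hx, hy⟩)))
  have hPconn : SetConn M P := (setConn_reachSet _ z).mono (isolate_le M S)
  have hends := hPconn.card_ends_add_le hM
  have hnd := card_sdiff_deep_le hM (P := P) fun x hx y hxy =>
    (hPcl x hx y hxy).imp_right fun h => hSD h
  let 𝓒 : Finset (Finset V) := {B ∈ 𝓑 | (B ∩ P).Nonempty}
  have hout : #𝓒 ≤ ∑ v ∈ P, degIn M (univ \ P) v := by
    have hex : ∀ B ∈ 𝓒, ∃ p : V × V, p.1 ∈ P ∧ p.2 ∉ P ∧ p.2 ∈ B ∧ M.Adj p.1 p.2 := by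
      intro B hB
      obtain ⟨hB, hne⟩ := mem_filter.1 hB
      obtain ⟨s, hsB, hsS⟩ := hS B hB
      obtain ⟨a, ha, c, hc, hcA, hac⟩ := (h𝓑 B hB).2.1 (B ∩ P) inter_subset_left hne (fun h =>
        hPS s (mem_inter.1 (h ▸ hsB)).2 hsS)
      exact ⟨(a, c), (mem_inter.1 ha).2, fun h => hcA (mem_inter.2 ⟨hc, h⟩), hc, hac⟩
    have : Nonempty (V × V) := ⟨(z, z)⟩
    choose! g hg using hex
    have : #𝓒 ≤ #(P.sigma fun v => {w ∈ univ \ P | M.Adj v w}) := by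
      refine card_le_card_of_injOn (fun B => ⟨(g B).1, (g B).2⟩) (fun B hB => ?_)
        fun B hB B' hB' h => ?_
      · obtain ⟨h1, h2, h3, h4⟩ := hg B hB
        simp [h1, h2, h4]
      · simp only [Sigma.mk.injEq, heq_eq_eq] at h
        refine hdisj B (mem_filter.1 hB).1 B' (mem_filter.1 hB').1 (g B).2 (hg B hB).2.2.1 ?_
        rw [h.2]
        exact (hg B' hB').2.2.1
    rwa [card_sigma] at this
  have hdeep : #(P ∩ deep M) ≤ #𝓒 * (2 * b - 2) := by
    have hsub : P ∩ deep M ⊆ 𝓒.biUnion fun B => B ∩ P := by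
      intro x hx
      obtain ⟨hxP, hxD⟩ := mem_inter.1 hx
      obtain ⟨B, hB, hxB⟩ := hcov z hbig x (mem_inter.2 ⟨hPC hxP, hxD⟩)
      exact mem_biUnion.2 ⟨B, mem_filter.2 ⟨hB, x, mem_inter.2 ⟨hxB, hxP⟩⟩,
        mem_inter.2 ⟨hxB, hxP⟩⟩
    refine (card_le_card hsub).trans (card_biUnion_le_card_mul _ _ _ fun B hB => ?_)
    obtain ⟨hB, -⟩ := mem_filter.1 hB
    obtain ⟨s, hsB, hsS⟩ := hS B hB
    have h1 : #(B ∩ P) < #B := card_lt_card (Finset.ssubset_iff_subset_ne.2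
      ⟨inter_subset_left, fun h => hPS s (mem_inter.1 (h.symm ▸ hsB)).2 hsS⟩)
    have := (h𝓑 B hB).2.2.2
    omega
  have hsplit := card_sdiff_add_card_inter P (deep M)
  have hc : #𝓒 ≤ 2 := by omega
  constructor
  · interval_cases #𝓒 <;> omega
  · rintro ⟨x, hx, hx1⟩
    have : 0 < #{v ∈ P | degIn M univ v ≤ 1} := card_pos.2 ⟨x, mem_filter.2 ⟨hx, hx1⟩⟩
    interval_cases #𝓒 <;> omega

end Pieces

/-! ### Optimal list colourings and their switches. -/

section MinimalColouring

open scoped Classical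
open Finset

variable {V : Type u} {α : Type w}

theorem update_mem {L : V → Finset α} {φ : V → α} {v : V} {c : α} (h : ∀ v, φ v ∈ L v) (hc : c ∈ L v) (x : V) :
    Function.update φ v c x ∈ L x := by
  by_cases hx : x = v
  · subst hx; simpa using hc
  · simpa [hx] using h x

variable [Fintype V]

/-- The number of neighbours of `v` with colour `c`. -/
noncomputable def nCol (G : SimpleGraph V) (φ : V → α) (v : V) (c : α) : ℕ :=
  #{w | G.Adj v w ∧ φ w = c}

/-- Twice the number of monochromatic edges. -/
noncomputable def cost (G : SimpleGraph V) (φ : V → α) : ℕ := ∑ v, nCol G φ v (φ v)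

theorem degIn_monoSubgraph (G : SimpleGraph V) (φ : V → α) (v : V) :
    degIn (monoSubgraph G φ) univ v = nCol G φ v (φ v) := by
  unfold degIn nCol
  congr 1
  ext w
  simp only [mem_filter, mem_univ, true_and]
  exact and_congr_right fun _ => eq_comm

theorem sum_nCol_le (G : SimpleGraph V) (φ : V → α) (v : V) (C : Finset α) :
    ∑ c ∈ C, nCol G φ v c ≤ degIn G univ v := by
  unfold nCol degIn
  rw [← card_biUnion]
  · refine card_le_card fun w hw => ?_
    simp only [mem_biUnion, mem_filter, mem_univ, true_and] at hw ⊢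
    obtain ⟨c, -, h, -⟩ := hw
    exact h
  · intro c _ c' _ hcc
    rw [Function.onFun, disjoint_left]
    intro w h h'
    simp only [mem_filter, mem_univ, true_and] at h h'
    exact hcc (h.2.symm.trans h'.2)

theorem sum_sum_eq_of_symm (f : V → V → ℕ) (hf : ∀ x y, f x y = f y x) (v : V) (hv : f v v = 0) :
    ∑ x, ∑ y, f x y =
      2 * ∑ y, f v y + ∑ x ∈ univ.erase v, ∑ y ∈ univ.erase v, f x y := by
  have h1 : ∀ x, ∑ y, f x y = f x v + ∑ y ∈ univ.erase v, f x y := fun x =>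
    (add_sum_erase _ _ (mem_univ v)).symm
  rw [← add_sum_erase _ _ (mem_univ v), sum_congr rfl fun x _ => h1 x, sum_add_distrib,
    sum_congr rfl fun x _ => hf x v]
  have h2 := h1 v
  have h3 : (univ.erase v).sum (f v) = ∑ y ∈ univ.erase v, f v y := rfl
  omega

theorem nCol_eq_sum (G : SimpleGraph V) (φ : V → α) (v : V) (c : α) :
    nCol G φ v c = ∑ w, if G.Adj v w ∧ φ w = c then 1 else 0 := by
  rw [nCol, card_filter]

theorem nCol_update_self (G : SimpleGraph V) (φ : V → α) (v : V) (c c' : α) :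
    nCol G (Function.update φ v c) v c' = nCol G φ v c' := by
  unfold nCol
  congr 1
  ext w
  simp only [mem_filter, mem_univ, true_and, and_congr_right_iff]
  intro h
  rw [Function.update_of_ne h.ne']

theorem nCol_update_of_not_adj (G : SimpleGraph V) (φ : V → α) {v x : V} (h : ¬ G.Adj v x)
    (c c' : α) : nCol G (Function.update φ v c) x c' = nCol G φ x c' := by
  unfold nCol
  congr 1
  ext w
  simp only [mem_filter, mem_univ, true_and, and_congr_right_iff]
  intro h'
  rw [Function.update_of_ne]
  rintro rfl
  exact h h'.symm

theorem nCol_update_of_adj (G : SimpleGraph V) (φ : V → α) {v x : V} (h : G.Adj v x)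
    {c : α} (hc : c ≠ φ v) : nCol G (Function.update φ v c) x c = nCol G φ x c + 1 := by
  unfold nCol
  rw [← card_insert_of_notMem (a := v) (s := {w | G.Adj x w ∧ φ w = c}) (by simp [hc.symm])]
  congr 1
  ext w
  simp only [mem_filter, mem_univ, true_and, mem_insert]
  by_cases hw : w = v
  · subst hw; simp [h.symm]
  · simp [hw]

theorem cost_update (G : SimpleGraph V) (φ : V → α) (v : V) (c : α) :
    cost G (Function.update φ v c) + 2 * nCol G φ v (φ v) = cost G φ + 2 * nCol G φ v c := by
  have key : ∀ ψ : V → α, cost G ψ = 2 * nCol G ψ v (ψ v) +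
      ∑ x ∈ univ.erase v, ∑ y ∈ univ.erase v, if G.Adj x y ∧ ψ y = ψ x then 1 else 0 := by
    intro ψ
    unfold cost
    simp only [nCol_eq_sum]
    refine sum_sum_eq_of_symm _ (fun x y => ?_) v (by simp)
    simp [G.adj_comm, eq_comm]
  have h1 := key φ
  have h2 := key (Function.update φ v c)
  rw [nCol_update_self, Function.update_self] at h2
  have h3 : (∑ x ∈ univ.erase v, ∑ y ∈ univ.erase v,
      if G.Adj x y ∧ Function.update φ v c y = Function.update φ v c x then 1 else 0) =
      ∑ x ∈ univ.erase v, ∑ y ∈ univ.erase v, if G.Adj x y ∧ φ y = φ x then 1 else 0 :=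
    sum_congr rfl fun x hx => sum_congr rfl fun y hy => by
      rw [Function.update_of_ne (ne_of_mem_erase hx), Function.update_of_ne (ne_of_mem_erase hy)]
  omega

/-- `φ` is an `L`-colouring with the fewest monochromatic edges. -/
def IsMinColouring (G : SimpleGraph V) (L : V → Finset α) (φ : V → α) : Prop :=
  (∀ v, φ v ∈ L v) ∧ ∀ ψ : V → α, (∀ v, ψ v ∈ L v) → cost G φ ≤ cost G ψ

/-- The number of vertices that are isolated in the monochromatic subgraph. -/
noncomputable def numIsolated (G : SimpleGraph V) (φ : V → α) : ℕ := #{v | nCol G φ v (φ v) = 0}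

/-- `φ` minimises the number of isolated vertices of the monochromatic subgraph among the
`L`-colourings with the fewest monochromatic edges. -/
def IsOptimal (G : SimpleGraph V) (L : V → Finset α) (φ : V → α) : Prop :=
  IsMinColouring G L φ ∧ ∀ ψ : V → α, IsMinColouring G L ψ → numIsolated G φ ≤ numIsolated G ψ

theorem exists_isOptimal (G : SimpleGraph V) (L : V → Finset α) (hL : ∀ v, (L v).Nonempty) :
    ∃ φ, IsOptimal G L φ := by
  have h1 : (Fintype.piFinset L).Nonempty := Fintype.piFinset_nonempty.2 hL
  obtain ⟨φ₀, hφ₀, hmin⟩ := exists_min_image _ (cost G) h1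
  have hm₀ : IsMinColouring G L φ₀ :=
    ⟨Fintype.mem_piFinset.1 hφ₀, fun ψ hψ => hmin ψ (Fintype.mem_piFinset.2 hψ)⟩
  obtain ⟨φ, hφ, hmin'⟩ := exists_min_image {ψ ∈ Fintype.piFinset L | IsMinColouring G L ψ}
    (numIsolated G) ⟨φ₀, mem_filter.2 ⟨hφ₀, hm₀⟩⟩
  exact ⟨φ, (mem_filter.1 hφ).2, fun ψ hψ =>
    hmin' ψ (mem_filter.2 ⟨Fintype.mem_piFinset.2 hψ.1, hψ⟩)⟩

variable {G : SimpleGraph V} {L : V → Finset α} {φ : V → α}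

theorem IsMinColouring.nCol_le (h : IsMinColouring G L φ) {v : V} {c : α} (hc : c ∈ L v) :
    nCol G φ v (φ v) ≤ nCol G φ v c := by
  have h1 := h.2 _ (update_mem h.1 hc)
  have h2 := cost_update G φ v c
  omega

theorem IsMinColouring.update (h : IsMinColouring G L φ) {v : V} {c : α} (hc : c ∈ L v)
    (he : nCol G φ v c = nCol G φ v (φ v)) : IsMinColouring G L (Function.update φ v c) := by
  refine ⟨update_mem h.1 hc, fun ψ hψ => ?_⟩
  have h1 := h.2 ψ hψ
  have h2 := cost_update G φ v c
  omega

/-- A vertex's own colour is a least frequent list colour on its neighbourhood. -/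
theorem IsMinColouring.mul_nCol_le (h : IsMinColouring G L φ) (v : V) :
    #(L v) * nCol G φ v (φ v) ≤ degIn G univ v := by
  refine le_trans ?_ (sum_nCol_le G φ v (L v))
  rw [← smul_eq_mul]
  exact card_nsmul_le_sum _ _ _ fun c hc => h.nCol_le hc

theorem IsMinColouring.nCol_le_two (h : IsMinColouring G L φ) {v : V}
    (hv : degIn G univ v < 3 * #(L v)) : nCol G φ v (φ v) ≤ 2 := by
  have h1 := h.mul_nCol_le v
  by_contra! h2
  have := Nat.mul_le_mul_left #(L v) h2
  simp only [Nat.succ_eq_add_one] at this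
  omega

variable (G L φ) in
/-- Recolouring `v` with `c` preserves the number of monochromatic edges, and `v` lies deep
inside its monochromatic component. -/
def IsSwitch (v : V) (c : α) : Prop :=
  c ∈ L v ∧ c ≠ φ v ∧ nCol G φ v c = 2 ∧ degIn G univ v + 2 ≤ 3 * #(L v) ∧
    v ∈ deep (monoSubgraph G φ)

theorem IsSwitch.nCol_self {v : V} {c : α} (h : IsSwitch G L φ v c) : nCol G φ v (φ v) = 2 := by
  rw [← degIn_monoSubgraph]; exact (mem_deep.1 h.2.2.2.2).1

theorem IsSwitch.update {v : V} {c : α} (h : IsSwitch G L φ v c) (hφ : IsMinColouring G L φ) :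
    IsMinColouring G L (Function.update φ v c) :=
  hφ.update h.1 (by rw [h.nCol_self, h.2.2.1])

/-- After the switch `u` gains a monochromatic edge and the colouring is still minimal, so `u` had
degree at most 1 before. Had it been 0, the switch would lower the number of isolated vertices: `u`
stops being isolated, and no vertex becomes isolated because the old neighbours of the deep vertex
`v` have degree 2. -/
theorem IsSwitch.nCol_target {v u : V} {c : α} (h : IsSwitch G L φ v c) (hφ : IsOptimal G L φ)
    (hL : ∀ v, degIn G univ v < 3 * #(L v)) (hvu : G.Adj v u) (hu : φ u = c) :
    nCol G φ u c = 1 := by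
  have hmin := h.update hφ.1
  have h1 := hmin.nCol_le_two (hL u)
  rw [Function.update_of_ne hvu.ne', hu, nCol_update_of_adj G φ hvu h.2.1] at h1
  by_contra hne
  have h0 : nCol G φ u c = 0 := by omega
  have h2 := hφ.2 _ hmin
  refine absurd h2 (not_le.2 (card_lt_card (Finset.ssubset_iff_subset_ne.2 ⟨?_, ?_⟩)))
  · intro x hx
    simp only [mem_filter, mem_univ, true_and] at hx ⊢
    by_contra hx0
    obtain ⟨y, hy⟩ := card_pos.1 (Nat.pos_of_ne_zero hx0)
    simp only [mem_filter, mem_univ, true_and] at hy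
    by_cases hxv : x = v
    · subst hxv
      rw [Function.update_self, nCol_update_self, h.2.2.1] at hx
      omega
    · rw [Function.update_of_ne hxv] at hx
      -- A newly isolated `x` had `v` as its only monochromatic neighbour, contradicting that `v` is
      -- deep.
      have hall : ∀ z, G.Adj x z → φ z = φ x → z = v := by
        intro z hz hzx
        by_contra hzv
        have : z ∈ ({w | G.Adj x w ∧ Function.update φ v c w = φ x} : Finset V) := by
          simp [hz, hzv, hzx]
        rw [card_eq_zero.1 hx] at this
        simp at this
      have hyv := hall y hy.1 hy.2
      subst hyv
      have h3 := (mem_deep.1 h.2.2.2.2).2 x ⟨hy.1.symm, hy.2⟩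
      rw [degIn_monoSubgraph] at h3
      have : nCol G φ x (φ x) ≤ 1 := card_le_one.2 fun a ha b hb => by
        simp only [mem_filter, mem_univ, true_and] at ha hb
        rw [hall a ha.1 ha.2, hall b hb.1 hb.2]
      omega
  · intro he
    have : u ∈ ({v | nCol G φ v (φ v) = 0} : Finset V) := by simp [hu, h0]
    rw [← he] at this
    simp only [mem_filter, mem_univ, true_and] at this
    rw [Function.update_of_ne hvu.ne', hu, nCol_update_of_adj G φ hvu h.2.1] at this
    omega

/-- If `v` and `v'` were nonadjacent, both switches could be made at no cost, raising the
monochromatic degree of `u` from 1 to 3. -/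
theorem IsSwitch.adj {v v' u : V} {c : α} (h : IsSwitch G L φ v c) (h' : IsSwitch G L φ v' c)
    (hφ : IsMinColouring G L φ) (hL : ∀ v, degIn G univ v < 3 * #(L v)) (hne : v ≠ v')
    (hvu : G.Adj v u) (hvu' : G.Adj v' u) (hu : φ u = c) (h1 : nCol G φ u c = 1) :
    G.Adj v v' := by
  by_contra hadj
  have hmin := h.update hφ
  have hv' : Function.update φ v c v' = φ v' := Function.update_of_ne hne.symm _ _
  have hmin' : IsMinColouring G L (Function.update (Function.update φ v c) v' c) := by
    refine hmin.update h'.1 ?_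
    rw [hv', nCol_update_of_not_adj G φ hadj, nCol_update_of_not_adj G φ hadj, h'.nCol_self,
      h'.2.2.1]
  have h2 := hmin'.nCol_le_two (hL u)
  rw [Function.update_of_ne hvu'.ne', Function.update_of_ne hvu.ne', hu,
    nCol_update_of_adj G _ hvu' (by rw [hv']; exact h'.2.1), nCol_update_of_adj G φ hvu h.2.1] at h2
  omega

/-- These vertices form a clique `T` by `IsSwitch.adj`, and each has degree at least twice its list
size. The list condition then leaves `|T|(|T| - 1) < Σ|L| ≤ |T|k`. -/
theorem card_switch_le {k : ℕ} (hk : ∀ v, #(L v) ≤ k) (hφ : IsMinColouring G L φ)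
    (hL : ∀ v, degIn G univ v < 3 * #(L v))
    (hsum : ∀ T : Finset V, T.Nonempty →
      ∑ v ∈ T, (degIn G univ v + degIn G T v) < 3 * ∑ v ∈ T, #(L v))
    {u : V} {c : α} (hu : φ u = c) (h1 : nCol G φ u c = 1) :
    #{v | IsSwitch G L φ v c ∧ G.Adj v u} ≤ k := by
  set T : Finset V := {v | IsSwitch G L φ v c ∧ G.Adj v u} with hT
  rcases T.eq_empty_or_nonempty with h0 | hne
  · simp [h0]
  have hmem : ∀ v, v ∈ T ↔ IsSwitch G L φ v c ∧ G.Adj v u := by simp [hT]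
  have h2 := hsum T hne
  have h3 : ∑ v ∈ T, (2 * #(L v) + (#T - 1)) ≤ ∑ v ∈ T, (degIn G univ v + degIn G T v) := by
    refine sum_le_sum fun v hv => add_le_add ?_ ?_
    · have := hφ.mul_nCol_le v
      rw [((hmem v).1 hv).1.nCol_self] at this
      omega
    · rw [← card_erase_of_mem hv]
      refine card_le_card fun w hw => ?_
      obtain ⟨hwv, hw⟩ := mem_erase.1 hw
      exact mem_filter.2 ⟨hw, ((hmem v).1 hv).1.adj ((hmem w).1 hw).1 hφ hL hwv.symm
        ((hmem v).1 hv).2 ((hmem w).1 hw).2 hu h1⟩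
  have h4 : ∑ v ∈ T, #(L v) ≤ #T * k := by
    simpa using sum_le_card_nsmul T _ k fun v _ => hk v
  rw [sum_add_distrib, ← mul_sum, sum_const, smul_eq_mul] at h3
  have h5 : #T * (#T - 1) < #T * k := by omega
  have := Nat.lt_of_mul_lt_mul_left h5
  omega

variable (G L φ) in
/-- The colours that `v` may switch to. -/
noncomputable def switchCols (v : V) : Finset α := {c ∈ L v | IsSwitch G L φ v c}

theorem mem_switchCols {v : V} {c : α} : c ∈ switchCols G L φ v ↔ IsSwitch G L φ v c := by
  simp only [switchCols, mem_filter, and_iff_right_iff_imp]; exact fun h => h.1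

/-- Every list colour occurs at least twice around `v`, and at least three times unless it occurs
exactly twice. Colours of the latter kind are switch colours, except for the present colour of `v`;
hence the `+ 1`. -/
theorem three_mul_card_le_of_mem_deep (hφ : IsMinColouring G L φ) {v : V}
    (hv : v ∈ deep (monoSubgraph G φ)) :
    3 * #(L v) ≤ degIn G univ v + #(switchCols G L φ v) + 1 := by
  by_cases hd : degIn G univ v + 2 ≤ 3 * #(L v)
  swap
  · omega
  have h2 : nCol G φ v (φ v) = 2 := by
    rw [← degIn_monoSubgraph]; exact (mem_deep.1 hv).1
  have h3 : ∑ c ∈ L v, 3 ≤ ∑ c ∈ L v, (nCol G φ v c + if nCol G φ v c = 2 then 1 else 0) :=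
    sum_le_sum fun c hc => by have := hφ.nCol_le hc; split_ifs <;> omega
  rw [sum_add_distrib, ← card_filter] at h3
  have h4 := sum_nCol_le G φ v (L v)
  have h5 : #(({c ∈ L v | nCol G φ v c = 2}).erase (φ v)) ≤ #(switchCols G L φ v) :=
    card_le_card fun c hc => by
      obtain ⟨h, hc⟩ := mem_erase.1 hc
      rw [mem_filter] at hc
      exact mem_switchCols.2 ⟨hc.1, h, hc.2, hd, hv⟩
  have h6 := pred_card_le_card_erase (s := ({c ∈ L v | nCol G φ v c = 2})) (a := φ v)
  simp only [sum_const, smul_eq_mul] at h3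
  omega

/-- Sum the previous bound over `B` and compare with the list condition, using that a connected `B`
has internal degree sum at least `2|B| - 2`. -/
theorem card_le_sum_card_switchCols (hφ : IsMinColouring G L φ)
    (hsum : ∀ T : Finset V, T.Nonempty →
      ∑ v ∈ T, (degIn G univ v + degIn G T v) < 3 * ∑ v ∈ T, #(L v))
    {B : Finset V} (hB : B ⊆ deep (monoSubgraph G φ)) (hconn : SetConn (monoSubgraph G φ) B) :
    #B ≤ ∑ v ∈ B, #(switchCols G L φ v) + 1 := by
  rcases B.eq_empty_or_nonempty with h0 | hne
  · simp [h0]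
  have h1 := (hconn.mono (N := G) fun _ _ h => h.1).two_mul_card_le
  have h2 := hsum B hne
  have h3 : ∑ v ∈ B, 3 * #(L v) ≤ ∑ v ∈ B, (degIn G univ v + #(switchCols G L φ v) + 1) :=
    sum_le_sum fun v hv => three_mul_card_le_of_mem_deep hφ (hB hv)
  simp only [sum_add_distrib, ← mul_sum, sum_const, smul_eq_mul, mul_one] at h2 h3
  omega

end MinimalColouring

/-! ### Choosing compatible switches and bounding the new components. -/

section Core

open scoped Classical
open Finset

variable {V : Type u} {α : Type w} [Fintype V] {G : SimpleGraph V} {L : V → Finset α} {φ : V → α}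

variable (G L φ) in
/-- Two switches conflict if performing both may merge components in an uncontrolled way. -/
def switchConflict : SimpleGraph (Σ v : V, switchCols G L φ v) where
  Adj p q := p.1 ≠ q.1 ∧ (p.2 : α) = q.2 ∧ (G.Adj p.1 q.1 ∨ ∃ u u', G.Adj p.1 u ∧ φ u = p.2 ∧
    G.Adj q.1 u' ∧ φ u' = q.2 ∧ u ≠ u' ∧ (monoSubgraph G φ).Reachable u u')
  symm := ⟨by
    rintro p q ⟨h1, h2, h3⟩
    refine ⟨h1.symm, h2.symm, h3.imp (fun h => h.symm) ?_⟩
    rintro ⟨u, u', h4, h5, h6, h7, h8, h9⟩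
    exact ⟨u', u, h6, h7, h4, h5, h8.symm, h9.symm⟩⟩
  loopless := ⟨fun p h => h.1 rfl⟩

/-- Adjacent conflicts come from neighbours outside the two targets: at most `(3k - 2) - 2`. For
each target, its path has at most one other end, and at most `k` switches of this colour are
adjacent to that end. In total `5k - 4`. -/
theorem card_switchConflict_le {k : ℕ} (hk : ∀ v, #(L v) ≤ k) (hφ : IsOptimal G L φ)
    (hL : ∀ v, degIn G univ v < 3 * #(L v))
    (hsum : ∀ T : Finset V, T.Nonempty →
      ∑ v ∈ T, (degIn G univ v + degIn G T v) < 3 * ∑ v ∈ T, #(L v))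
    (p : Σ v : V, switchCols G L φ v) : #{q | (switchConflict G L φ).Adj p q} ≤ 5 * k - 4 := by
  obtain ⟨v, c, hc⟩ := p
  have hs : IsSwitch G L φ v c := mem_switchCols.1 hc
  set M := monoSubgraph G φ with hMdef
  have hM : ∀ x, degIn M univ x ≤ 2 := fun x => by
    rw [degIn_monoSubgraph]; exact hφ.1.nCol_le_two (hL x)
  let N : Finset V := {w | G.Adj v w}
  let C : Finset V := {w | G.Adj v w ∧ φ w = c}
  let F : V → Finset V := fun u => {v' | IsSwitch G L φ v' c ∧ ∃ u', G.Adj v' u' ∧ φ u' = c ∧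
    u ≠ u' ∧ M.Reachable u u'}
  have hdeg : ∀ v' u, IsSwitch G L φ v' c → G.Adj v' u → φ u = c → degIn M univ u = 1 :=
    fun v' u h1 h2 h3 => by
      rw [degIn_monoSubgraph, h3]; exact h1.nCol_target hφ hL h2 h3
  have hF : ∀ u ∈ C, #(F u) ≤ k := by
    intro u hu
    obtain ⟨hvu, huc⟩ : G.Adj v u ∧ φ u = c := by simpa [C] using hu
    rcases (F u).eq_empty_or_nonempty with h0 | ⟨v', hv'⟩
    · simp [h0]
    simp only [F, mem_filter, mem_univ, true_and] at hv'
    obtain ⟨hs', u', h1, h2, h3, h4⟩ := hv'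
    refine le_trans (card_le_card fun x hx => ?_)
      (card_switch_le hk hφ.1 hL hsum h2 (hs'.nCol_target hφ hL h1 h2))
    simp only [F, mem_filter, mem_univ, true_and] at hx ⊢
    obtain ⟨hx, y, h5, h6, h7, h8⟩ := hx
    have : u' = y := eq_of_reachable_of_degIn_le_one hM h4 h8 (hdeg v u hs hvu huc).le
      (hdeg v' u' hs' h1 h2).le (hdeg x y hx h5 h6).le h3 h7
    exact ⟨hx, this ▸ h5⟩
  have hsub : #{q | (switchConflict G L φ).Adj ⟨v, c, hc⟩ q} ≤ #((N \ C) ∪ C.biUnion F) := by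
    refine card_le_card_of_injOn (fun q => q.1) ?_ ?_
    · rintro ⟨v', c', hc'⟩ hq
      simp only [coe_filter, mem_univ, true_and, Set.mem_ofPred_eq] at hq
      obtain ⟨h1, rfl, h3⟩ := hq
      have hs' : IsSwitch G L φ v' c := mem_switchCols.1 hc'
      simp only [coe_union, Set.mem_union, mem_coe]
      rcases h3 with h3 | ⟨u, u', h4, h5, h6, h7, h8, h9⟩
      · left
        simp only [N, C, mem_sdiff, mem_filter, mem_univ, true_and]
        refine ⟨h3, fun h => ?_⟩
        have h4 := hdeg v v' hs h.1 h.2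
        have h5 := (mem_deep.1 hs'.2.2.2.2).1
        exact absurd (h4.symm.trans h5) (by norm_num)
      · right
        simp only [mem_biUnion, C, F, mem_filter, mem_univ, true_and]
        exact ⟨u, ⟨h4, h5⟩, hs', u', h6, h7, h8, h9⟩
    · rintro ⟨v', c', hc'⟩ hq ⟨v'', c'', hc''⟩ hq' h
      simp only [coe_filter, mem_univ, true_and, Set.mem_ofPred_eq] at hq hq' h
      obtain ⟨-, rfl, -⟩ := hq
      obtain ⟨-, rfl, -⟩ := hq'
      subst h
      rfl
  have h1 : #(N \ C) + #C = #N := card_sdiff_add_card_eq_card fun x hx => by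
    simp only [C, N, mem_filter, mem_univ, true_and] at hx ⊢; exact hx.1
  have h2 : #C = 2 := hs.2.2.1
  have h3 : #N = degIn G univ v := rfl
  have h4 : #(C.biUnion F) ≤ #C * k := card_biUnion_le_card_mul _ _ _ hF
  have h5 := card_union_le (N \ C) (C.biUnion F)
  have h6 := hs.2.2.2.1
  have h7 := hk v
  rw [h2] at h4
  omega

/-- A set `S` of vertices meeting every block, and a compatible choice `g` of new colours. -/
theorem exists_switches {k : ℕ} (hk : ∀ v, #(L v) ≤ k) (hφ : IsOptimal G L φ)
    (hL : ∀ v, degIn G univ v < 3 * #(L v))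
    (hsum : ∀ T : Finset V, T.Nonempty →
      ∑ v ∈ T, (degIn G univ v + degIn G T v) < 3 * ∑ v ∈ T, #(L v))
    {𝓑 : Finset (Finset V)}
    (h𝓑 : ∀ B ∈ 𝓑, B ⊆ deep (monoSubgraph G φ) ∧ SetConn (monoSubgraph G φ) B ∧
      2 * (5 * k - 4) + 2 ≤ #B)
    (hdisj : ∀ B ∈ 𝓑, ∀ B' ∈ 𝓑, ∀ v ∈ B, v ∈ B' → B = B') :
    ∃ (S : Finset V) (g : V → α), (∀ v ∈ S, IsSwitch G L φ v (g v)) ∧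
      (∀ B ∈ 𝓑, ∃ s ∈ B, s ∈ S) ∧
      ∀ v ∈ S, ∀ v' ∈ S, v ≠ v' → g v = g v' → ¬ G.Adj v v' ∧ ∀ u u', G.Adj v u → φ u = g v →
        G.Adj v' u' → φ u' = g v → u ≠ u' → ¬ (monoSubgraph G φ).Reachable u u' := by
  rcases 𝓑.eq_empty_or_nonempty with rfl | ⟨B₀, hB₀⟩
  · exact ⟨∅, φ, by simp⟩
  -- The empty set labels vertices outside all blocks; it is not itself a block, since blocks are
  -- nonempty.
  have hblk : ∀ v, ∃ B : Finset V, ∀ B' ∈ 𝓑, v ∈ B' ↔ B' = B ∧ B.Nonempty := by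
    intro v
    by_cases h : ∃ B ∈ 𝓑, v ∈ B
    · obtain ⟨B, hB, hv⟩ := h
      refine ⟨B, fun B' hB' => ⟨fun h => ⟨hdisj B' hB' B hB v h hv, v, hv⟩, ?_⟩⟩
      rintro ⟨rfl, -⟩
      exact hv
    · push Not at h
      exact ⟨∅, fun B' hB' => by simp [h B' hB']⟩
  choose blk hblk using hblk
  have hne : ∀ B ∈ 𝓑, B.Nonempty := fun B hB => card_pos.1 (by
    have := (h𝓑 B hB).2.2; omega)
  let P := Σ v : V, switchCols G L φ v
  have hmemblk : ∀ (p : P), ∀ B ∈ 𝓑, (blk p.1 = B ↔ p.1 ∈ B) := by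
    intro p B hB
    rw [hblk p.1 B hB]
    constructor
    · rintro rfl; exact ⟨rfl, hne _ hB⟩
    · rintro ⟨rfl, -⟩; rfl
  have hcard : ∀ B ∈ 𝓑, 2 * (5 * k - 4) < #{p : P | blk p.1 = B} := by
    intro B hB
    have h1 := card_le_sum_card_switchCols hφ.1 hsum (h𝓑 B hB).1 (h𝓑 B hB).2.1
    have h2 : #{p : P | blk p.1 = B} = ∑ v ∈ B, #(switchCols G L φ v) := by
      have : ({p : P | blk p.1 = B} : Finset P) = B.sigma fun v => univ := by
        ext p
        simp only [mem_filter, mem_univ, true_and]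
        exact (hmemblk p B hB).trans
          ⟨fun h => mem_sigma.2 ⟨h, mem_univ _⟩, fun h => (mem_sigma.1 h).1⟩
      rw [this, card_sigma]
      simp
    have := (h𝓑 B hB).2.2
    omega
  have hP : Nonempty P := by
    obtain ⟨p, -⟩ := card_pos.1 (Nat.zero_lt_of_lt (hcard B₀ hB₀))
    exact ⟨p⟩
  obtain ⟨t, ht1, ht2⟩ := exists_isTransversal (switchConflict G L φ) (fun p : P => blk p.1) _
    (card_switchConflict_le hk hφ hL hsum) 𝓑 fun B hB => by convert hcard B hB
  have htB : ∀ B ∈ 𝓑, (t B).1 ∈ B := fun B hB => (hmemblk _ B hB).1 (ht1 B hB).2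
  let col : P → α := fun p => p.2
  have hg : ∀ B ∈ 𝓑, col (t (blk (t B).1)) = col (t B) := fun B hB =>
    congrArg (fun B => col (t B)) (ht1 B hB).2
  refine ⟨𝓑.image fun B => (t B).1, fun v => col (t (blk v)), ?_, ?_, ?_⟩
  · intro v hv
    obtain ⟨B, hB, rfl⟩ := mem_image.1 hv
    beta_reduce
    rw [hg B hB]
    exact mem_switchCols.1 (t B).2.2
  · exact fun B hB => ⟨(t B).1, htB B hB, mem_image_of_mem _ hB⟩
  · intro v hv v' hv' hvv hgg
    obtain ⟨B, hB, rfl⟩ := mem_image.1 hv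
    obtain ⟨B', hB', rfl⟩ := mem_image.1 hv'
    beta_reduce at hgg ⊢
    rw [hg B hB, hg B' hB'] at hgg
    rw [hg B hB]
    have h := ht2 B hB B' hB'
    refine ⟨fun hadj => h ⟨hvv, hgg, Or.inl hadj⟩, fun u u' h1 h2 h3 h4 h5 h6 => ?_⟩
    exact h ⟨hvv, hgg, Or.inr ⟨u, u', h1, h2, h3, h4.trans hgg, h5, h6⟩⟩

theorem HasClustering.of_card_reachSet_le {ψ : V → α} {c : ℕ}
    (h : ∀ v, #(reachSet (monoSubgraph G ψ) v) ≤ c) : HasClustering G ψ c := by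
  intro C
  induction C using SimpleGraph.ConnectedComponent.ind with
  | _ v =>
  have : (((monoSubgraph G ψ).connectedComponentMk v).supp : Set V) =
      (reachSet (monoSubgraph G ψ) v : Set V) := by
    ext w
    rw [SimpleGraph.ConnectedComponent.mem_supp_iff, SimpleGraph.ConnectedComponent.eq, mem_coe,
      mem_reachSet]
    exact SimpleGraph.reachable_comm
  rw [this, Set.encard_coe_eq_coe_finsetCard]
  exact_mod_cast h v

theorem exists_clustering_of_two_le {k : ℕ} (hk2 : 2 ≤ k) (hk : ∀ v, #(L v) ≤ k)
    (hL : ∀ v, degIn G univ v < 3 * #(L v))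
    (hsum : ∀ T : Finset V, T.Nonempty →
      ∑ v ∈ T, (degIn G univ v + degIn G T v) < 3 * ∑ v ∈ T, #(L v)) :
    ∃ ψ : V → α, (∀ v, ψ v ∈ L v) ∧ ∀ v, #(reachSet (monoSubgraph G ψ) v) ≤ 40 * k - 23 := by
  obtain ⟨φ, hφ⟩ := exists_isOptimal G L fun v => card_pos.1 (by have := hL v; omega)
  set M := monoSubgraph G φ with hMdef
  have hM : ∀ x, degIn M univ x ≤ 2 := fun x => by
    rw [degIn_monoSubgraph]; exact hφ.1.nCol_le_two (hL x)
  -- `10k - 6 = 2(5k - 4) + 2`: a block of this size has at least `2(5k - 4) + 1` switches, as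
  -- Haxell's theorem requires.
  obtain ⟨𝓑, h𝓑, hdisj, hcov⟩ := exists_blocks hM (b := 10 * k - 6) (by omega)
  obtain ⟨S, g, hsw, hmeet, hcomp⟩ := exists_switches hk hφ hL hsum (𝓑 := 𝓑)
    (fun B hB => ⟨(h𝓑 B hB).1, (h𝓑 B hB).2.1, by have := (h𝓑 B hB).2.2.1; omega⟩) hdisj
  have hpiece := fun z => card_reachSet_isolate_le hM (b := 10 * k - 6) (by omega) h𝓑 hdisj hcov
    (fun v hv => (hsw v hv).2.2.2.2) hmeet (z := z)
  set R := fun z => reachSet (isolate M S) z with hR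
  let ψ : V → α := fun v => if v ∈ S then g v else φ v
  have hψS : ∀ v ∈ S, ψ v = g v := fun v hv => if_pos hv
  have hψ : ∀ v, v ∉ S → ψ v = φ v := fun v hv => if_neg hv
  have hends : ∀ s ∈ S, ∀ u, G.Adj s u → φ u = g s → degIn M univ u = 1 ∧ u ∉ S := by
    intro s hs u hsu hu
    have h1 : degIn M univ u = 1 := by
      rw [degIn_monoSubgraph, hu]; exact (hsw s hs).nCol_target hφ hL hsu hu
    refine ⟨h1, fun h => ?_⟩
    exact absurd (h1.symm.trans (mem_deep.1 (hsw u h).2.2.2.2).1) (by norm_num)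
  have hRS : ∀ u, u ∉ S → ∀ x ∈ R u, x ∉ S := by
    intro u hu
    have : R u ⊆ univ \ S := reachSet_subset (by simp [hu]) fun x _ y hxy => by simp [hxy.2.2]
    exact fun x hx => (mem_sdiff.1 (this hx)).2
  have hRM : ∀ u, ∀ x ∈ R u, M.Reachable u x := fun u x hx =>
    (mem_reachSet.1 hx).mono (isolate_le M S)
  have hMcol : ∀ u x, M.Reachable u x → φ x = φ u := by
    intro u x h
    have : reachSet M u ⊆ ({y | φ y = φ u} : Finset V) :=
      reachSet_subset (by simp) fun a ha b hab => by
        simp only [mem_filter, mem_univ, true_and] at ha ⊢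
        exact hab.2.symm.trans ha
    simpa using this (mem_reachSet.2 h)
  have hstep : ∀ u x y, x ∈ R u → x ∉ S → y ∉ S → (monoSubgraph G ψ).Adj x y → y ∈ R u := by
    intro u x y hx hxS hyS hxy
    refine mem_reachSet.2 ((mem_reachSet.1 hx).trans
      (SimpleGraph.Adj.reachable (G := isolate M S) ⟨⟨hxy.1, ?_⟩, hxS, hyS⟩))
    rw [← hψ x hxS, ← hψ y hyS]
    exact hxy.2
  refine ⟨ψ, fun v => ?_, fun z => ?_⟩
  · by_cases hv : v ∈ S
    · rw [hψS v hv]; exact (hsw v hv).1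
    · rw [hψ v hv]; exact hφ.1.1 v
  by_cases hzS : ∃ s ∈ S, s ∈ reachSet (monoSubgraph G ψ) z
  · obtain ⟨s, hs, hsz⟩ := hzS
    rw [← reachSet_eq (mem_reachSet.1 hsz)]
    let C : Finset V := {w | G.Adj s w ∧ φ w = g s}
    have hC : #C = 2 := (hsw s hs).2.2.1
    have hCmem : ∀ u, u ∈ C ↔ G.Adj s u ∧ φ u = g s := by simp [C]
    -- The pieces at the two targets of `s` contain ends, so each has at most `2b` vertices, giving
    -- `4b + 1 = 40k - 23` in total. They meet no other switched vertex of this colour: reaching one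
    -- through a different vertex of the piece is a conflict, and sharing the target itself forces
    -- adjacency.
    have hsub : reachSet (monoSubgraph G ψ) s ⊆ insert s (C.biUnion R) := by
      refine reachSet_subset (mem_insert_self _ _) fun x hx y hxy => ?_
      have hcol : ψ x = ψ y := hxy.2
      rcases mem_insert.1 hx with rfl | hx
      · by_cases hyS : y ∈ S
        · rw [hψS x hs, hψS y hyS] at hcol
          exact absurd hxy.1 (hcomp x hs y hyS hxy.1.ne hcol).1
        · rw [hψS x hs, hψ y hyS] at hcol
          exact mem_insert_of_mem (mem_biUnion.2
            ⟨y, (hCmem y).2 ⟨hxy.1, hcol.symm⟩, mem_reachSet.2 (SimpleGraph.Reachable.refl y)⟩)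
      · obtain ⟨u, hu, hxu⟩ := mem_biUnion.1 hx
        obtain ⟨hsu, huc⟩ := (hCmem u).1 hu
        have huS := (hends s hs u hsu huc).2
        have hxS := hRS u huS x hxu
        by_cases hyS : y ∈ S
        · by_cases hys : y = s
          · rw [hys]; exact mem_insert_self _ _
          exfalso
          have hxc : φ x = g s := (hMcol u x (hRM u x hxu)).trans huc
          rw [hψ x hxS, hψS y hyS] at hcol
          have hgg : g s = g y := hxc.symm.trans hcol
          have hc := hcomp s hs y hyS (Ne.symm hys) hgg
          by_cases hux : u = x
          · subst hux
            refine hc.1 (IsSwitch.adj (hsw s hs) (hgg ▸ hsw y hyS) hφ.1 hL (Ne.symm hys) hsu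
              hxy.1.symm huc ((hsw s hs).nCol_target hφ hL hsu huc))
          · exact hc.2 u x hsu huc hxy.1.symm hxc hux (hRM u x hxu)
        · exact mem_insert_of_mem (mem_biUnion.2 ⟨u, hu, hstep u x y hxu hxS hyS hxy⟩)
    have h1 := card_le_card hsub
    have h2 := card_insert_le s (C.biUnion R)
    have h3 : #(C.biUnion R) ≤ #C * (2 * (10 * k - 6)) := card_biUnion_le_card_mul _ _ _
      fun u hu => by
        obtain ⟨hsu, huc⟩ := (hCmem u).1 hu
        obtain ⟨hd, huS⟩ := hends s hs u hsu huc
        exact (hpiece u huS).2 ⟨u, mem_reachSet.2 (SimpleGraph.Reachable.refl u), hd.le⟩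
    rw [hC] at h3
    omega
  · push Not at hzS
    have hz : z ∉ S := fun h => hzS z h (mem_reachSet.2 (SimpleGraph.Reachable.refl z))
    have hsub : reachSet (monoSubgraph G ψ) z ⊆ R z ∩ reachSet (monoSubgraph G ψ) z := by
      refine reachSet_subset ?_ fun x hx y hxy => ?_
      · exact mem_inter.2 ⟨mem_reachSet.2 (SimpleGraph.Reachable.refl z),
          mem_reachSet.2 (SimpleGraph.Reachable.refl z)⟩
      · obtain ⟨hx1, hx2⟩ := mem_inter.1 hx
        have hy : y ∈ reachSet (monoSubgraph G ψ) z :=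
          mem_reachSet.2 ((mem_reachSet.1 hx2).trans hxy.reachable)
        exact mem_inter.2 ⟨hstep z x y hx1 (fun h => hzS x h hx2) (fun h => hzS y h hy) hxy, hy⟩
    have h1 := card_le_card (hsub.trans inter_subset_left)
    have h2 : #(R z) ≤ _ := (hpiece z hz).1
    omega

theorem exists_clustering {k : ℕ} (hk1 : 1 ≤ k) (hk : ∀ v, #(L v) ≤ k)
    (hsum : ∀ T : Finset V, T.Nonempty →
      ∑ v ∈ T, (degIn G univ v + degIn G T v) < 3 * ∑ v ∈ T, #(L v)) :
    ∃ ψ : V → α, (∀ v, ψ v ∈ L v) ∧ ∀ v, #(reachSet (monoSubgraph G ψ) v) ≤ 57 * k - 51 := by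
  have hL : ∀ v, degIn G univ v < 3 * #(L v) := fun v => by
    have := hsum {v} (singleton_nonempty v)
    simp only [sum_singleton] at this
    omega
  -- For `k = 1` the lists are single colours. The list condition and connectedness bound every
  -- component by 3.
  rcases hk1.lt_or_eq with hk2 | rfl
  · obtain ⟨ψ, h1, h2⟩ := exists_clustering_of_two_le hk2 hk hL hsum
    exact ⟨ψ, h1, fun v => (h2 v).trans (by omega)⟩
  have hne : ∀ v, (L v).Nonempty := fun v => card_pos.1 (by have := hL v; omega)
  choose ψ hψ using hne
  refine ⟨ψ, hψ, fun v => ?_⟩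
  set T := reachSet (monoSubgraph G ψ) v with hT
  have h1 := ((setConn_reachSet (monoSubgraph G ψ) v).mono (N := G)
    fun _ _ h => h.1).two_mul_card_le
  have h2 := hsum T ⟨v, mem_reachSet.2 (SimpleGraph.Reachable.refl v)⟩
  have h3 : ∑ v ∈ T, #(L v) ≤ #T * 1 := by
    simpa using sum_le_card_nsmul T _ 1 fun v _ => hk v
  have h4 : ∑ v ∈ T, degIn G T v ≤ ∑ v ∈ T, degIn G univ v :=
    sum_le_sum fun v _ => degIn_mono G (subset_univ T) v
  rw [sum_add_distrib] at h2
  rw [← hT] at h1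
  omega

end Core

/-! ### From bounded density to the list condition. -/

section Reduction

open scoped Classical
open Finset

variable {V : Type u} {α : Type w}

/-- The spanning subgraph of `G` consisting of the edges with both ends in `A`. -/
def edgesIn (G : SimpleGraph V) (A : Finset V) : SimpleGraph V where
  Adj x y := G.Adj x y ∧ x ∈ A ∧ y ∈ A
  symm := ⟨fun _ _ h => ⟨h.1.symm, h.2.2, h.2.1⟩⟩
  loopless := ⟨fun x h => G.loopless.irrefl x h.1⟩

/-- Greedy: when a vertex is added, some colour in its list has so far been used at most `|A|/k`
times. -/
theorem exists_balanced (k : ℕ) (hk : 1 ≤ k) (L : V → Finset α) (hL : ∀ v, k ≤ #(L v))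
    (A : Finset V) :
    ∃ φ : V → α, (∀ v, φ v ∈ L v) ∧ ∀ c, k * #{v ∈ A | φ v = c} < #A + k := by
  induction A using Finset.induction_on with
  | empty =>
    choose φ hφ using fun v => card_pos.1 (hk.trans (hL v))
    exact ⟨φ, hφ, fun c => by simp; omega⟩
  | insert a A ha ih =>
    obtain ⟨φ, hφ, hbal⟩ := ih
    obtain ⟨c, hc, hcA⟩ : ∃ c ∈ L a, k * #{v ∈ A | φ v = c} ≤ #A := by
      by_contra! hcon
      have h1 : ∑ c ∈ L a, (#A + 1) ≤ ∑ c ∈ L a, k * #{v ∈ A | φ v = c} :=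
        sum_le_sum fun c hc => hcon c hc
      have h2 : ∑ c ∈ L a, #{v ∈ A | φ v = c} ≤ #A := by
        rw [← card_biUnion]
        · exact card_le_card (biUnion_subset.2 fun c _ => filter_subset _ _)
        · intro c _ c' _ hcc
          rw [Function.onFun, disjoint_left]
          intro w h h'
          exact hcc ((mem_filter.1 h).2.symm.trans (mem_filter.1 h').2)
      rw [← mul_sum, sum_const, smul_eq_mul] at h1
      have h3 := Nat.mul_le_mul_left k h2
      have h4 := Nat.mul_le_mul_right (#A + 1) (hL a)
      nlinarith
    refine ⟨Function.update φ a c, fun v => update_mem hφ hc v, fun c' => ?_⟩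
    have h1 : #{v ∈ A | Function.update φ a c v = c'} = #{v ∈ A | φ v = c'} := by
      congr 1
      exact filter_congr fun v hv => by
        rw [Function.update_of_ne (fun h => ha (by rwa [← h]))]
    rw [filter_insert, Function.update_self, card_insert_of_notMem ha]
    split_ifs with h
    · subst h
      rw [card_insert_of_notMem (by simp [ha]), h1, mul_add]
      omega
    · rw [h1]
      have := hbal c'
      omega

/-- Moving `T` into `R` changes the potential by the expected amount. -/
theorem sum_degIn_union (G : SimpleGraph V) (A : Finset V) {R T : Finset V} (hRT : Disjoint R T) :
    ∑ v ∈ R ∪ T, (degIn G A v + degIn G (R ∪ T) v) =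
      ∑ v ∈ R, (degIn G A v + degIn G R v) +
        ∑ v ∈ T, (degIn G A v + 2 * degIn G R v + degIn G T v) := by
  have h1 : ∀ v, degIn G (R ∪ T) v = degIn G R v + degIn G T v := fun v => by
    unfold degIn
    rw [filter_union, card_union_of_disjoint (disjoint_filter_filter hRT)]
  have h2 : ∑ v ∈ R, degIn G T v = ∑ v ∈ T, degIn G R v := by
    unfold degIn
    have := sum_card_bipartiteAbove_eq_sum_card_bipartiteBelow (s := R) (t := T) G.Adj
    simp only [bipartiteAbove, bipartiteBelow, G.adj_comm] at this ⊢
    exact this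
  rw [sum_union hRT]
  simp only [h1, sum_add_distrib, ← mul_sum, h2]
  ring

theorem exists_extendable {k : ℕ} (G : SimpleGraph V) (A : Finset V)
    (hA : 2 * ∑ v ∈ A, degIn G A v < 3 * k * #A) :
    ∃ R ⊆ A, R ≠ A ∧ ∀ T ⊆ A \ R, T.Nonempty →
      ∑ v ∈ T, (degIn G (A \ R) v + degIn G T v + 3 * degIn G R v) < 3 * k * #T := by
  -- Among maximisers of `h`, one of largest cardinality is taken, so that adding any nonempty `T`
  -- strictly decreases `h`; this gives the strict inequality.
  let h : Finset V → ℤ := fun R =>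
    (∑ v ∈ R, (degIn G A v + degIn G R v) : ℕ) - 3 * k * (#R : ℤ)
  obtain ⟨R₀, hR₀, hmax₀⟩ := exists_max_image A.powerset h ⟨∅, by simp⟩
  obtain ⟨R, hR, hmax⟩ := exists_max_image {R ∈ A.powerset | h R = h R₀} card
    ⟨R₀, by simpa using hR₀⟩
  rw [mem_filter, mem_powerset] at hR
  refine ⟨R, hR.1, ?_, fun T hT hne => ?_⟩
  · rintro rfl
    have h1 := hmax₀ ∅ (by simp)
    rw [← hR.2] at h1
    simp only [h, sum_empty, card_empty, sum_add_distrib] at h1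
    push_cast at h1
    zify at hA
    simp only [mul_zero, sub_zero] at h1
    linarith
  · have hdis : Disjoint R T := disjoint_left.2 fun x hx hx' => (mem_sdiff.1 (hT hx')).2 hx
    have hsub : R ∪ T ⊆ A := union_subset hR.1 (hT.trans sdiff_subset)
    have hlt : h (R ∪ T) < h R := by
      rw [hR.2]
      refine lt_of_le_of_ne (hmax₀ _ (mem_powerset.2 hsub)) fun he => ?_
      have := hmax (R ∪ T) (mem_filter.2 ⟨mem_powerset.2 hsub, he⟩)
      rw [card_union_of_disjoint hdis] at this
      have := card_pos.2 hne
      omega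
    simp only [h, sum_degIn_union G A hdis, card_union_of_disjoint hdis] at hlt
    have hdeg : ∀ v, degIn G A v = degIn G (A \ R) v + degIn G R v := fun v => by
      unfold degIn
      rw [← card_union_of_disjoint (disjoint_filter_filter sdiff_disjoint), ← filter_union,
        sdiff_union_of_subset hR.1]
    have h2 : ∑ v ∈ T, (degIn G A v + 2 * degIn G R v + degIn G T v) =
        ∑ v ∈ T, (degIn G (A \ R) v + degIn G T v + 3 * degIn G R v) :=
      sum_congr rfl fun v _ => by rw [hdeg v]; ring
    rw [h2] at hlt
    push_cast at hlt
    zify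
    linarith

variable [Fintype V]

theorem exists_clustering_on {k : ℕ} (hk : 1 ≤ k) (G : SimpleGraph V) (n₀ c : ℕ)
    (hc : 57 * k - 51 ≤ c) (hc' : n₀ ≤ k * c + 1)
    (hG : ∀ A : Finset V, n₀ ≤ #A → 2 * ∑ v ∈ A, degIn G A v < 3 * k * #A)
    (L : V → Finset α) (hL : ∀ v, k ≤ #(L v)) (A : Finset V) :
    ∃ φ : V → α, (∀ v, φ v ∈ L v) ∧
      ∀ v, #(reachSet (monoSubgraph (edgesIn G A) φ) v) ≤ c := by
  induction hn : #A using Nat.strong_induction_on generalizing A with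
  | _ n ih =>
  subst hn
  by_cases hA : #A < n₀
  · obtain ⟨φ, hφ, hbal⟩ := exists_balanced k hk L hL A
    refine ⟨φ, hφ, fun v => ?_⟩
    -- Here `#A ≤ k * c`, so in a balanced colouring even a whole colour class has at most `c`
    -- vertices.
    have h1 : #{w ∈ A | φ w = φ v} ≤ c := by
      by_contra! hlt
      have h2 := hbal (φ v)
      have h3 := Nat.mul_le_mul_left k (Nat.succ_le_of_lt hlt)
      rw [Nat.succ_eq_add_one, mul_add] at h3
      omega
    by_cases hv : v ∈ A
    · refine (card_le_card (reachSet_subset (by simp [hv]) fun x hx y hxy => ?_)).trans h1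
      simp only [mem_filter] at hx ⊢
      exact ⟨hxy.1.2.2, hxy.2.symm.trans hx.2⟩
    · have : reachSet (monoSubgraph (edgesIn G A) φ) v ⊆ {v} :=
        reachSet_subset (mem_singleton_self v) fun x hx y hxy => by
          rw [mem_singleton] at hx; subst hx; exact absurd hxy.1.2.1 hv
      have := card_le_card this
      rw [card_singleton] at this
      omega
  · obtain ⟨R, hRA, hne, hT⟩ := exists_extendable G A (hG A (not_lt.1 hA))
    set X := A \ R with hX
    obtain ⟨φ, hφ, hφc⟩ := ih #R
      (card_lt_card (Finset.ssubset_iff_subset_ne.2 ⟨hRA, hne⟩)) R rfl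
    have hdegR : ∀ v ∈ X, degIn G R v < k := fun v hv => by
      have := hT {v} (by simpa using hv) (singleton_nonempty v)
      simp only [sum_singleton, card_singleton] at this
      omega
    -- Lists are trimmed to exact size, since the core needs the upper bound `k`. Vertices outside
    -- `X` are isolated in `edgesIn G X`, and one colour each satisfies the list condition there.
    have hlist : ∀ v, ∃ C ⊆ L v, (v ∈ X → #C = k - degIn G R v ∧
        ∀ w ∈ R, G.Adj v w → φ w ∉ C) ∧ (v ∉ X → #C = 1) := by
      intro v
      by_cases hv : v ∈ X
      · have h1 : k - degIn G R v ≤ #(L v \ ({w ∈ R | G.Adj v w}.image φ)) := by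
          have h2 := le_card_sdiff ({w ∈ R | G.Adj v w}.image φ) (L v)
          have h3 : #({w ∈ R | G.Adj v w}.image φ) ≤ degIn G R v := card_image_le
          have h4 := hL v
          omega
        obtain ⟨C, hC, hCc⟩ := exists_subset_card_eq h1
        refine ⟨C, hC.trans sdiff_subset, fun _ => ⟨hCc, fun w hw hvw hwC => ?_⟩,
          fun h => absurd hv h⟩
        exact (mem_sdiff.1 (hC hwC)).2 (mem_image_of_mem _ (mem_filter.2 ⟨hw, hvw⟩))
      · obtain ⟨C, hC, hCc⟩ := exists_subset_card_eq (hk.trans (hL v))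
        exact ⟨C, hC, fun h => absurd h hv, fun _ => hCc⟩
    choose L' hL'L hL'X hL'N using hlist
    obtain ⟨ψ, hψ, hψc⟩ := exists_clustering (G := edgesIn G X) (L := L') hk (fun v => by
      by_cases hv : v ∈ X
      · rw [(hL'X v hv).1]; omega
      · rw [hL'N v hv]; exact hk) (by
      intro T hTne
      have hsplit : ∀ f : V → ℕ, ∑ v ∈ T, f v =
          ∑ v ∈ T ∩ X, f v + ∑ v ∈ T \ X, f v := fun f => (sum_inter_add_sum_sdiff T X f).symm
      have hout : ∀ v, v ∉ X → ∀ S, degIn (edgesIn G X) S v = 0 := fun v hv S =>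
        card_eq_zero.2 (filter_eq_empty_iff.2 fun w _ h => hv h.2.1)
      have hin1 : ∀ v, degIn (edgesIn G X) univ v ≤ degIn G X v := fun v =>
        card_le_card fun w hw => by
          simp only [mem_filter, mem_univ, true_and] at hw ⊢
          exact ⟨hw.2.2, hw.1⟩
      have hin2 : ∀ v, degIn (edgesIn G X) T v ≤ degIn G (T ∩ X) v := fun v =>
        card_le_card fun w hw => by
          simp only [mem_filter, mem_inter] at hw ⊢
          exact ⟨⟨hw.1, hw.2.2.2⟩, hw.2.1⟩
      rw [hsplit, hsplit]
      have e1 : ∑ v ∈ T \ X, (degIn (edgesIn G X) univ v + degIn (edgesIn G X) T v) = 0 :=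
        sum_eq_zero fun v hv => by
          rw [hout v (mem_sdiff.1 hv).2 univ, hout v (mem_sdiff.1 hv).2 T, add_zero]
      have e2 : ∑ v ∈ T \ X, #(L' v) = #(T \ X) := by
        rw [card_eq_sum_ones]
        exact sum_congr rfl fun v hv => hL'N v (mem_sdiff.1 hv).2
      have e3 : ∑ v ∈ T ∩ X, (degIn (edgesIn G X) univ v + degIn (edgesIn G X) T v) ≤
          ∑ v ∈ T ∩ X, (degIn G X v + degIn G (T ∩ X) v) :=
        sum_le_sum fun v _ => add_le_add (hin1 v) (hin2 v)
      have e4 : ∑ v ∈ T ∩ X, #(L' v) + ∑ v ∈ T ∩ X, degIn G R v = k * #(T ∩ X) := by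
        rw [← sum_add_distrib, mul_comm, ← smul_eq_mul, ← sum_const]
        refine sum_congr rfl fun v hv => ?_
        have hv := (mem_inter.1 hv).2
        rw [(hL'X v hv).1]
        have := hdegR v hv
        omega
      rw [e1, e2]
      rcases (T ∩ X).eq_empty_or_nonempty with h0 | h0
      · rw [h0]
        have : 0 < #(T \ X) := by
          have := card_sdiff_add_card_inter T X
          rw [h0, card_empty] at this
          have := card_pos.2 hTne
          omega
        simp only [sum_empty]
        omega
      · have e5 := hT (T ∩ X) inter_subset_right h0
        rw [sum_add_distrib (g := fun v => 3 * degIn G R v), ← mul_sum, mul_assoc, ← e4] at e5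
        omega)
    let χ : V → α := fun v => if v ∈ X then ψ v else φ v
    have hχX : ∀ v ∈ X, χ v = ψ v := fun v hv => if_pos hv
    have hχ : ∀ v, v ∉ X → χ v = φ v := fun v hv => if_neg hv
    have hcross : ∀ x ∈ X, ∀ y ∈ R, ¬ (G.Adj x y ∧ χ x = χ y) := by
      rintro x hx y hy ⟨hxy, he⟩
      rw [hχX x hx, hχ y (fun h => (mem_sdiff.1 h).2 hy)] at he
      exact (hL'X x hx).2 y hy hxy (he ▸ hψ x)
    refine ⟨χ, fun v => ?_, fun v => ?_⟩
    · by_cases hv : v ∈ X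
      · rw [hχX v hv]; exact hL'L v (hψ v)
      · rw [hχ v hv]; exact hφ v
    by_cases hv : v ∈ X
    · refine le_trans (card_le_card ?_) ((hψc v).trans hc)
      have : reachSet (monoSubgraph (edgesIn G A) χ) v ⊆
          X ∩ reachSet (monoSubgraph (edgesIn G X) ψ) v := by
        refine reachSet_subset (mem_inter.2 ⟨hv, mem_reachSet.2 (.refl _)⟩) fun x hx y hxy => ?_
        obtain ⟨hx, hxr⟩ := mem_inter.1 hx
        have hyX : y ∈ X := by
          by_contra hy
          refine hcross x hx y ?_ ⟨hxy.1.1, hxy.2⟩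
          by_contra hyR
          exact hy (mem_sdiff.2 ⟨hxy.1.2.2, hyR⟩)
        refine mem_inter.2 ⟨hyX, mem_reachSet.2 ((mem_reachSet.1 hxr).trans
          (SimpleGraph.Adj.reachable ⟨⟨hxy.1.1, hx, hyX⟩, ?_⟩))⟩
        rw [← hχX x hx, ← hχX y hyX]
        exact hxy.2
      exact this.trans inter_subset_right
    · refine le_trans (card_le_card ?_) (hφc v)
      have : reachSet (monoSubgraph (edgesIn G A) χ) v ⊆
          (univ \ X) ∩ reachSet (monoSubgraph (edgesIn G R) φ) v := by
        refine reachSet_subset (mem_inter.2 ⟨by simpa using hv, mem_reachSet.2 (.refl _)⟩)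
          fun x hx y hxy => ?_
        obtain ⟨hx, hxr⟩ := mem_inter.1 hx
        have hx : x ∉ X := (mem_sdiff.1 hx).2
        have hxR : x ∈ R := by
          by_contra h
          exact hx (mem_sdiff.2 ⟨hxy.1.2.1, h⟩)
        have hyX : y ∉ X := fun hy => hcross y hy x hxR ⟨hxy.1.1.symm, hxy.2.symm⟩
        have hyR : y ∈ R := by
          by_contra h
          exact hyX (mem_sdiff.2 ⟨hxy.1.2.2, h⟩)
        refine mem_inter.2 ⟨by simpa using hyX, mem_reachSet.2 ((mem_reachSet.1 hxr).trans
          (SimpleGraph.Adj.reachable ⟨⟨hxy.1.1, hxR, hyR⟩, ?_⟩))⟩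
        rw [← hχ x hx, ← hχ y hyX]
        exact hxy.2
      exact this.trans inter_subset_right

/-- A bound on `mad` bounds the number of edges induced by each large set. -/
theorem two_mul_sum_degIn_lt {G : SimpleGraph V} {n₀ k : ℕ} (hn₀ : 1 ≤ n₀)
    (hmad : mad G n₀ < (3 / 2 : ℝ) * (k : ℝ)) (A : Finset V) (hA : n₀ ≤ #A) :
    2 * ∑ v ∈ A, degIn G A v < 3 * k * #A := by
  have hV : n₀ ≤ Nat.card V := by
    rw [Nat.card_eq_fintype_card]; exact hA.trans (card_le_univ A)
  let H : G.Subgraph := (⊤ : G.Subgraph).induce (A : Set V)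
  have hverts : H.verts.ncard = #A := Set.ncard_coe_finset A
  have hle : avgDegree H ≤ mad G n₀ :=
    (isGreatest_mad G n₀ hV).2 ⟨H, by rw [hverts]; exact hA, rfl⟩
  have hedge : H.edgeSet = (edgesIn G A).edgeSet := by
    ext e
    induction e using Sym2.ind with
    | _ x y => simp [H, edgesIn]; tauto
  have hcount : ∑ v ∈ A, degIn G A v = 2 * H.edgeSet.ncard := by
    rw [hedge, ← SimpleGraph.coe_edgeFinset, Set.ncard_coe_finset,
      ← SimpleGraph.sum_degrees_eq_twice_card_edges]
    rw [← sum_subset (subset_univ A)]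
    · refine sum_congr rfl fun v hv => ?_
      rw [← SimpleGraph.card_neighborFinset_eq_degree]
      refine congrArg card ?_
      ext w
      rw [SimpleGraph.mem_neighborFinset]
      simp [edgesIn, hv, and_comm]
    · intro v _ hv
      rw [← SimpleGraph.card_neighborFinset_eq_degree, card_eq_zero]
      ext w
      rw [SimpleGraph.mem_neighborFinset]
      simp [edgesIn, hv]
  have hpos : (0 : ℝ) < #A := by exact_mod_cast hn₀.trans hA
  have h1 := hle.trans_lt hmad
  rw [avgDegree, hverts, div_lt_iff₀ hpos] at h1
  rw [hcount]
  have h2 : (2 * (2 * H.edgeSet.ncard : ℕ) : ℝ) < 3 * k * #A := by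
    push_cast
    linarith
  exact_mod_cast h2

end Reduction

end ClusteredChoosability

theorem mainTheorem6 {V : Type u} [Finite V] (G : SimpleGraph V) (n₀ k : ℕ)
    (hn₀ : 1 ≤ n₀) (hk : 1 ≤ k)
    (hmad : ClusteredChoosability.mad G n₀ < (3 / 2 : ℝ) * (k : ℝ)) :
    ClusteredChoosability.ChoosableWithClustering.{u, w} G k
      (max ⌈((n₀ : ℝ) - 1) / (k : ℝ)⌉₊ (57 * k - 51)) := by
  classical
  have := Fintype.ofFinite V
  intro α L hL
  have hL' : ∀ v, ∃ C : Finset α, (C : Set α) ⊆ L v ∧ k ≤ C.card := by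
    intro v
    obtain ⟨t, ht, htk⟩ := Set.exists_subset_encard_eq (hL v)
    have hfin : t.Finite := Set.finite_of_encard_eq_coe htk
    refine ⟨hfin.toFinset, by simpa using ht, ?_⟩
    rw [hfin.encard_eq_coe_toFinset_card] at htk
    exact_mod_cast htk.ge
  choose C hCL hCk using hL'
  obtain ⟨φ, hφ, hc⟩ := ClusteredChoosability.exists_clustering_on hk G n₀
    (max ⌈((n₀ : ℝ) - 1) / (k : ℝ)⌉₊ (57 * k - 51)) (le_max_right _ _) (by
      have hk0 : (0 : ℝ) < k := by exact_mod_cast hk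
      have h1 := Nat.le_ceil (((n₀ : ℝ) - 1) / (k : ℝ))
      rw [div_le_iff₀ hk0] at h1
      have h2 : n₀ ≤ k * ⌈((n₀ : ℝ) - 1) / (k : ℝ)⌉₊ + 1 := by
        have : (n₀ : ℝ) ≤ k * (⌈((n₀ : ℝ) - 1) / (k : ℝ)⌉₊ : ℝ) + 1 := by linarith
        exact_mod_cast this
      exact h2.trans (by gcongr; exact le_max_left _ _))
    (ClusteredChoosability.two_mul_sum_degIn_lt hn₀ hmad) C hCk Finset.univ
  refine ⟨φ, fun v => hCL v (hφ v), ClusteredChoosability.HasClustering.of_card_reachSet_le ?_⟩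
  have hG : ClusteredChoosability.edgesIn G Finset.univ = G := by
    ext x y
    simp [ClusteredChoosability.edgesIn]
  rwa [hG] at hc
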